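/- **Setting.** Let $V$ be a finite set of sites, each carrying a spin with Hilbert space $\mathbb{C}^q$, and let $H=\sum_j h_j$ where each $h_j$ is a Hermitian operator acting on a finite set $Z_j\subseteq V$ of sites. Two sites are neighbours if some $Z_j$ contains both; $d(x,y)$ is the length of a shortest path of neighbours ($\infty$ if there is none), and $d(X,Y)=\min_{x\in X,y\in Y}d(x,y)$ for $X,Y\subseteq V$ ($\infty$ if $X$ or $Y$ is empty). For $R\subseteq V$ let $H_R=\sum_{j:Z_j\subseteq R}h_j$; its energies are its eigenvalues on the truncated space $(\mathbb{C}^q)^{\otimes R}$. For $X\subseteq V$ and real $l\ge 0$ write $H_X^l=H_R$ with $R=\{x: d(x,X)\le l\}$. An observable on $X$ is a Hermitian operator acting only on $X$ with operator norm $1$; $A(t)=e^{itH}Ae^{-itH}$. Let $E_k$ be the eigenvalues of $H$ (with multiplicity) and $\Theta(E)=\#\{k: E_k\le E\}$. We put $e^{-\mu\infty}=0$, and every bound below that contains $e^{-\mu d}$ with $d=\infty$ is read as $0$. * $H$ is *strongly dynamically localised* with constants $c_{\rm loc},\mu>0$ if $\|A(t)-e^{itH_X^l}Ae^{-itH_X^l}\|\le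 c_{\rm loc}e^{-\mu l}$ for all $X$, all observables $A$ on $X$, all real $l\ge0$ and all $t\ge0$. * $H$ has a *mobility edge* at $E_{\rm mob}$ with constants $c_{\rm mob},\mu>0$ if $|\mathrm{tr}(\rho[A(t),B])|\le \min(t,1)\,c_{\rm mob}\,e^{-\mu d(X,Y)}$ for all $t\ge 0$, all observables $A$ on $X$ and $B$ on $Y$ with $X\cap Y=\emptyset$, and all density operators $\rho$ in the linear span of the operators $|\varphi\rangle\langle\chi|$ with $\varphi,\chi$ eigenvectors of $H$ of energies $\le E_{\rm mob}$. * **AI**: the eigenvalues of $H$ are non-degenerate. * **AII** for two regions $R,S$: the energies $E_a$ of $H_R$ and $E_b$ of $H_S$ are non-degenerate on the truncated Hilbert spaces, and $E_a-E_{a'}=E_b-E_{b'}$ implies $a=a'$, $b=b'$. * **AIII**: there is $\zeta>0$ with $\bigl||E_r-E_k|-|E_s-E_k|\bigr|\ge\zeta$ for all $k$ and all $r\ne s$. **Theorem 1 (Clustering of correlations of eigenvectors).** Let $X,Y\subseteq V$ be disjoint, $d=d(X,Y)$, and let $A$, $B$ be observables on $X$, $Y$. **(a)** If $H$ is strongly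 dynamically localised with constants $c_{\rm loc},\mu$ and satisfies AI, and AII holds for the regions $\{x: 2d(x,X)<d\}$ and $\{x: 2d(x,Y)<d\}$, then every normalised eigenvector $|k\rangle$ of $H$ satisfies $$|\langle k|AB|k\rangle-\langle k|A|k\rangle\langle k|B|k\rangle|\le 4c_{\rm loc}\,e^{-\mu d/2}.$$ **(b)** If $H$ has a mobility edge at $E_{\rm mob}$ with constants $c_{\rm mob},\mu$ and satisfies AI and AIII, then for every normalised eigenvector $|k\rangle$ of energy $E_k\le E_{\rm mob}$ and every $\kappa>0$ $$|\langle k|AB|k\rangle-\langle k|A|k\rangle\langle k|B|k\rangle|\le\Bigl(12\pi\,\Theta(E_k+\kappa)\,c_{\rm mob}+2\pi+c_{\rm mob}\ln\bigl(e^{4}\max(1,\tfrac{\pi\mu d}{\kappa^2})\bigr)\Bigr)\frac{e^{-\mu d}}{2\pi}.$$ If moreover $d<\infty$, $\kappa^2\le e^4\pi\mu d$, and $c_{\rm mob}\le1$ or $\ln(\pi\mu d\,e^{4}/\kappa^2)\le 4\pi(2\Theta(E_k+\kappa)+1)$, then also $$|\langle k|AB|k\rangle-\langle k|A|k\rangle\langle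 k|B|k\rangle|\le\Bigl(12\pi\,\Theta(E_k+\kappa)\,c_{\rm mob}+\ln\frac{\pi\mu d\,e^{4+2\pi}}{\kappa^2}\Bigr)\frac{e^{-\mu d}}{2\pi}.$$ -/

import Mathlib

open scoped Matrix.Norms.L2Operator ComplexOrder

noncomputable section

namespace SpinLattice

/-- Classical configurations of a system of `q`-level spins on the sites `S`: they label the
product basis of the Hilbert space `(ℂ^q)^{⊗ S}`. -/
abbrev Conf (S : Type*) (q : ℕ) : Type _ := S → Fin q

/-- Operators on the Hilbert space `(ℂ^q)^{⊗ S}`, as matrices in the product basis. Their norm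
is the operator norm. -/
abbrev Op (S : Type*) (q : ℕ) : Type _ := Matrix (Conf S q) (Conf S q) ℂ

open Classical in
/-- For an injection `f : S → T` of sites, the operator `M ⊗ 1` on the sites `T` which acts as `M`
on the sites `f(S)` and as the identity on all the other sites. -/
def embed {S T : Type*} {q : ℕ} (f : S → T) (M : Op S q) : Op T q :=
  fun σ τ => if ∀ x, x ∉ Set.range f → σ x = τ x then M (σ ∘ f) (τ ∘ f) else 0

theorem embed_isHermitian {S T : Type*} {q : ℕ} (f : S → T) {M : Op S q}
    (hM : M.IsHermitian) : (embed f M).IsHermitian := by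
  ext σ τ
  simp only [Matrix.conjTranspose_apply, embed]
  by_cases h : ∀ x, x ∉ Set.range f → σ x = τ x
  · have h' : ∀ x, x ∉ Set.range f → τ x = σ x := fun x hx => (h x hx).symm
    rw [if_pos h, if_pos h', hM.apply]
  · have h' : ¬ ∀ x, x ∉ Set.range f → τ x = σ x := fun h' => h fun x hx => (h' x hx).symm
    rw [if_neg h, if_neg h', star_zero]

/-- A local Hamiltonian `H = ∑ j, h j` of `q`-level spins on the sites `V`: the term `h j` is a
Hermitian operator on the sites in `supp j`. -/
structure LocalHamiltonian (V ι : Type*) (q : ℕ) where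
  /-- the set of sites on which the `j`-th interaction acts -/
  supp : ι → Finset V
  /-- the `j`-th interaction -/
  term : (j : ι) → Op (supp j) q
  isHermitian_term : ∀ j, (term j).IsHermitian

/-- The Heisenberg evolution `e^{itG} A e^{-itG}`. -/
def heisenberg {S : Type*} [Fintype S] [DecidableEq S] {q : ℕ} (G : Op S q) (t : ℝ)
    (A : Op S q) : Op S q :=
  NormedSpace.exp ((Complex.I * (t : ℂ)) • G) * A * NormedSpace.exp (-(Complex.I * (t : ℂ)) • G)

/-- `A` is an observable of norm one which acts only on the sites in `X`. -/
def IsObservableOn {V : Type*} [Fintype V] [DecidableEq V] {q : ℕ} (X : Finset V)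
    (A : Op V q) : Prop :=
  A.IsHermitian ∧ (∃ a : Op X q, A = embed (Subtype.val : X → V) a) ∧ ‖A‖ = 1

/-- `ψ` is a normalised vector. -/
def IsUnitVector {S : Type*} [Fintype S] [DecidableEq S] {q : ℕ} (ψ : Conf S q → ℂ) : Prop :=
  star ψ ⬝ᵥ ψ = 1

/-- The expectation value `⟨ψ|A|ψ⟩`. -/
def expectation {S : Type*} [Fintype S] [DecidableEq S] {q : ℕ} (ψ : Conf S q → ℂ)
    (A : Op S q) : ℂ :=
  star ψ ⬝ᵥ (A.mulVec ψ)

/-- `e^{-μ D}`, which is `0` for `D = ∞`. -/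
def expDecay (μ : ℝ) (D : ℕ∞) : ℝ :=
  if D = ⊤ then 0 else Real.exp (-μ * (D.toNat : ℝ))

namespace LocalHamiltonian

variable {V ι : Type*} [Fintype ι] {q : ℕ}
variable (H : LocalHamiltonian V ι q)

/-- The full Hamiltonian `H = ∑ j, h j`. -/
def full : Op V q := ∑ j, embed (Subtype.val : H.supp j → V) (H.term j)

theorem full_isHermitian : H.full.IsHermitian := by
  unfold full Matrix.IsHermitian
  rw [Matrix.conjTranspose_sum]
  exact Finset.sum_congr rfl fun j _ => embed_isHermitian _ (H.isHermitian_term j)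

variable [DecidableEq V]

/-- The Hamiltonian made of all the interactions contained in the region `R`, as an operator on
the whole lattice. -/
def trunc (R : Finset V) : Op V q :=
  ∑ j with H.supp j ⊆ R, embed (Subtype.val : H.supp j → V) (H.term j)

/-- The Hamiltonian made of all the interactions contained in the region `R`, as an operator on
the truncated Hilbert space of the sites in `R`. -/
def region (R : Finset V) : Op R q :=
  ∑ j, if h : H.supp j ⊆ R then
    embed (fun x : H.supp j => (⟨x.1, h x.2⟩ : R)) (H.term j) else 0

theorem region_isHermitian (R : Finset V) : (H.region R).IsHermitian := by
  unfold region Matrix.IsHermitian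
  rw [Matrix.conjTranspose_sum]
  refine Finset.sum_congr rfl fun j _ => ?_
  split_ifs with h
  · exact embed_isHermitian _ (H.isHermitian_term j)
  · exact Matrix.conjTranspose_zero

variable [Fintype V]

/-- The energies of the full Hamiltonian, repeated according to multiplicity. -/
def energy : Conf V q → ℝ := H.full_isHermitian.eigenvalues

/-- The energies of the Hamiltonian of the region `R` on the truncated Hilbert space of `R`,
repeated according to multiplicity. -/
def regionEnergy (R : Finset V) : Conf R q → ℝ := (H.region_isHermitian R).eigenvalues

/-- The number `Θ(E)` of eigenstates of `H` of energy at most `E`. -/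
def numStates (E : ℝ) : ℕ := Nat.card {k : Conf V q // H.energy k ≤ E}

/-- `ψ` satisfies `H ψ = E ψ`. -/
def IsEigen (ψ : Conf V q → ℂ) (E : ℝ) : Prop := H.full.mulVec ψ = (E : ℂ) • ψ

/-- Two different sites are neighbours if some interaction acts on both. -/
def interactionGraph : SimpleGraph V where
  Adj x y := x ≠ y ∧ ∃ j, x ∈ H.supp j ∧ y ∈ H.supp j
  symm := ⟨fun _ _ h => ⟨h.1.symm, h.2.imp fun _ hj => ⟨hj.2, hj.1⟩⟩⟩
  loopless := ⟨fun _ h => h.1 rfl⟩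

/-- The distance `d(X, Y)` of two sets of sites: the length of the shortest path of interactions
that connects them (`∞` if there is none). -/
def dist (X Y : Finset V) : ℕ∞ := ⨅ x ∈ X, ⨅ y ∈ Y, H.interactionGraph.edist x y

open Classical in
/-- The sites at distance at most `l` from `X`. -/
def nbhd (X : Finset V) (l : ℝ) : Finset V :=
  {x | ∃ y ∈ X, H.interactionGraph.Reachable y x ∧ (H.interactionGraph.dist y x : ℝ) ≤ l}

open Classical in
/-- The sites whose distance from `X` is less than half of the distance `d(X, Y)`. -/
def halfway (X Y : Finset V) : Finset V :=
  {x | ∃ y ∈ X, 2 * H.interactionGraph.edist y x < H.dist X Y}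

/-- Strong dynamical localisation with constants `c` and `μ`. -/
def StrongDynamicalLocalisation (c μ : ℝ) : Prop :=
  0 < c ∧ 0 < μ ∧
    ∀ (X : Finset V) (A : Op V q), IsObservableOn X A → ∀ l : ℝ, 0 ≤ l → ∀ t : ℝ, 0 ≤ t →
      ‖heisenberg H.full t A - heisenberg (H.trunc (H.nbhd X l)) t A‖ ≤ c * Real.exp (-μ * l)

/-- The linear span of the operators `|φ⟩⟨χ|` for eigenvectors `φ`, `χ` of `H` of energy at most
`Emob`. -/
def lowEnergySpan (Emob : ℝ) : Submodule ℂ (Op V q) :=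
  Submodule.span ℂ {M | ∃ (φ χ : Conf V q → ℂ) (E E' : ℝ),
    H.IsEigen φ E ∧ H.IsEigen χ E' ∧ E ≤ Emob ∧ E' ≤ Emob ∧ M = Matrix.vecMulVec φ (star χ)}

/-- `H` has a mobility edge at the energy `Emob` with constants `c` and `μ`: zero velocity
commutator bounds hold in all states `ρ` supported on the energies up to `Emob`, for observables
with disjoint supports. -/
def HasMobilityEdge (Emob c μ : ℝ) : Prop :=
  0 < c ∧ 0 < μ ∧
    ∀ ρ : Op V q, ρ ∈ H.lowEnergySpan Emob → ρ.PosSemidef → ρ.trace = 1 →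
      ∀ (X Y : Finset V), Disjoint X Y → ∀ A B : Op V q,
        IsObservableOn X A → IsObservableOn Y B → ∀ t : ℝ, 0 ≤ t →
          ‖(ρ * (heisenberg H.full t A * B - B * heisenberg H.full t A)).trace‖ ≤
            min t 1 * c * expDecay μ (H.dist X Y)

/-- Non-degenerate energies. -/
def NondegenerateEnergies : Prop := Function.Injective H.energy

/-- Locally independent gaps, for the two regions `R` and `S`. -/
def LocallyIndependentGaps (R S : Finset V) : Prop :=
  Function.Injective (H.regionEnergy R) ∧ Function.Injective (H.regionEnergy S) ∧
    ∀ (a a' : Conf R q) (b b' : Conf S q),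
      H.regionEnergy R a - H.regionEnergy R a' = H.regionEnergy S b - H.regionEnergy S b' →
        a = a' ∧ b = b'

/-- Non-symmetric gaps. -/
def NonsymmetricGaps : Prop :=
  ∃ ζ : ℝ, 0 < ζ ∧ ∀ k r s : Conf V q, r ≠ s →
    ζ ≤ |(|H.energy r - H.energy k| - |H.energy s - H.energy k|)|

end LocalHamiltonian

end SpinLattice

end

/-!
The *time mean* of a function `f` is `lim (1/T) ∫₀ᵀ f`. The time mean of `A(t)` is the dephasing
`𝔼 A = ∑ₓ Pₓ A Pₓ` of `A` over the spectral projections of the Hamiltonian, and a simple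
eigenvector `ψ` satisfies `(𝔼 A) ψ = ⟨A⟩ ψ`, so that `⟨𝔼 A · 𝔼 B⟩ = ⟨A⟩⟨B⟩`.

For strong dynamical localisation, replace `H` by the Hamiltonians `H₁`, `H₂` of the two halfway
regions. By conservation, `⟨AB⟩ = ⟨A(t)B(t)⟩` is close to `⟨A₁(t)B₂(t)⟩`, whose time mean factorises
into `⟨𝔼₁ A · 𝔼₂ B⟩` because `H₁` and `H₂` have no common energy gap; and the latter is close to
`⟨𝔼 A · 𝔼 B⟩`. Each of the two steps costs two light cone errors.

For a mobility edge, write `⟨A B(t)⟩ - ⟨A⟩⟨B⟩ = ∑ₓ Cₓ exp(i(x - E)t)`, where `x` runs over the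
energies other than `E`; the correlation is its value `∑ₓ Cₓ` at `t = 0`. Only the imaginary part is
controlled, by the commutator `[A(t), B]`. Integrating it against a Gaussian divided by `t` bounds
`∑ₓ f(x - E) Re Cₓ` for a smoothed sign function `f`, and `∑ₓ Im Cₓ = 0`. It remains to bound the
sum with the weights `1 - f(x - E)`. For the energies up to `E + κ`, the time mean of the imaginary
part against `exp(-i(x - E)t)` isolates each `Cₓ`, as the numbers `|x - E|` are distinct. Above
`E + κ` the weights form a Gaussian tail, which functional calculus turns into an operator norm. The
width of the Gaussian is chosen so that this tail matches `e^{-μd}`.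
-/

section Spectral

open Matrix

variable {n : Type*} [Fintype n] [DecidableEq n] {G : Matrix n n ℂ}

/-- The finite set of distinct eigenvalues of a Hermitian matrix. -/
noncomputable def realSpectrum (G : Matrix n n ℂ) : Finset ℝ := G.finite_real_spectrum.toFinset

/-- The orthogonal projection onto the eigenspace of the Hermitian matrix `G` at the energy `x`;
it is `0` when `x` is not an eigenvalue. -/
noncomputable def spectralProj (G : Matrix n n ℂ) (x : ℝ) : Matrix n n ℂ := cfc (Pi.single x 1) G

theorem mem_realSpectrum {x : ℝ} : x ∈ realSpectrum G ↔ x ∈ spectrum ℝ G :=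
  Set.Finite.mem_toFinset _

theorem continuousOn_spectrum (f : ℝ → ℝ) : ContinuousOn f (spectrum ℝ G) :=
  G.finite_real_spectrum.continuousOn f

theorem isHermitian_spectralProj (G : Matrix n n ℂ) (x : ℝ) : (spectralProj G x).IsHermitian :=
  IsSelfAdjoint.cfc

theorem sum_smul_spectralProj (G : Matrix n n ℂ) (f : ℝ → ℝ) :
    ∑ x ∈ realSpectrum G, f x • spectralProj G x = cfc f G := by
  simp only [spectralProj, ← cfc_smul (f _) (Pi.single _ 1) G (continuousOn_spectrum _)]
  rw [← cfc_sum _ _ _ fun _ _ => continuousOn_spectrum _]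
  refine cfc_congr fun y hy => ?_
  simp [Finset.sum_apply, Pi.single_apply, mem_realSpectrum.2 hy]

theorem sum_spectralProj (hG : G.IsHermitian) : ∑ x ∈ realSpectrum G, spectralProj G x = 1 := by
  simpa [cfc_const_one ℝ G hG.isSelfAdjoint] using sum_smul_spectralProj G fun _ => 1

theorem norm_sum_smul_spectralProj_le (G : Matrix n n ℂ) {f : ℝ → ℝ} {C : ℝ} (hC : 0 ≤ C)
    (hf : ∀ x ∈ realSpectrum G, |f x| ≤ C) :
    ‖∑ x ∈ realSpectrum G, f x • spectralProj G x‖ ≤ C := by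
  rw [sum_smul_spectralProj]
  exact norm_cfc_le hC fun x hx => hf x (mem_realSpectrum.2 hx)

theorem mul_spectralProj (hG : G.IsHermitian) (x : ℝ) :
    G * spectralProj G x = (x : ℂ) • spectralProj G x := by
  calc G * spectralProj G x = cfc (fun y => y * Pi.single (M := fun _ => ℝ) x 1 y) G := by
        rw [cfc_mul _ _ G (continuousOn_spectrum _) (continuousOn_spectrum _),
          cfc_id' ℝ G hG.isSelfAdjoint]
        rfl
    _ = cfc (x • Pi.single (M := fun _ => ℝ) x 1) G := by
        refine cfc_congr fun y _ => ?_
        by_cases h : y = x <;> simp [h]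
    _ = (x : ℂ) • spectralProj G x := by
        rw [Complex.coe_smul]
        exact cfc_smul x (Pi.single x 1) G (continuousOn_spectrum _)

theorem spectralProj_mul (hG : G.IsHermitian) (x : ℝ) :
    spectralProj G x * G = (x : ℂ) • spectralProj G x := by
  have h := congrArg conjTranspose (mul_spectralProj hG x)
  simpa [(isHermitian_spectralProj G x).eq, hG.eq] using h

theorem exp_mul_of_mul_eq_smul {M P : Matrix n n ℂ} {c : ℂ} (h : M * P = c • P) :
    NormedSpace.exp M * P = Complex.exp c • P := by
  have hpow : ∀ k : ℕ, M ^ k * P = c ^ k • P := fun k => by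
    induction k with
    | zero => simp
    | succ k ih => rw [pow_succ, mul_assoc, h, mul_smul_comm, ih, smul_smul, pow_succ']
  have hM := (NormedSpace.exp_series_hasSum_exp' (𝕂 := ℂ) M).mul_right P
  have hc := (NormedSpace.exp_series_hasSum_exp' (𝕂 := ℂ) c).smul_const P
  rw [Complex.exp_eq_exp_ℂ]
  refine hM.unique (hc.congr_fun fun k => ?_)
  rw [smul_mul_assoc, hpow, smul_assoc]

theorem exp_smul_eq_sum (hG : G.IsHermitian) (z : ℂ) :
    NormedSpace.exp (z • G) =
      ∑ x ∈ realSpectrum G, Complex.exp (z * x) • spectralProj G x := by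
  rw [← mul_one (NormedSpace.exp (z • G)), ← sum_spectralProj hG, Finset.mul_sum]
  refine Finset.sum_congr rfl fun x _ => exp_mul_of_mul_eq_smul ?_
  rw [smul_mul_assoc, mul_spectralProj hG, smul_smul]

variable {ψ : n → ℂ} {E : ℝ}

theorem spectralProj_mulVec_of_ne (hG : G.IsHermitian) (hψ : G *ᵥ ψ = (E : ℂ) • ψ) {x : ℝ}
    (hx : x ≠ E) : spectralProj G x *ᵥ ψ = 0 := by
  have h : ((x : ℂ) - E) • spectralProj G x *ᵥ ψ = 0 := by
    rw [sub_smul, ← smul_mulVec, ← spectralProj_mul hG, ← mulVec_mulVec, hψ, mulVec_smul, sub_self]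
  exact (smul_eq_zero.1 h).resolve_left (sub_ne_zero.2 (Complex.ofReal_injective.ne hx))

theorem mem_realSpectrum_of_mulVec_eq (hG : G.IsHermitian) (hψ : G *ᵥ ψ = (E : ℂ) • ψ)
    (h0 : ψ ≠ 0) : E ∈ realSpectrum G := by
  by_contra hE
  refine h0 ?_
  rw [← one_mulVec ψ, ← sum_spectralProj hG, sum_mulVec]
  exact Finset.sum_eq_zero fun x hx =>
    spectralProj_mulVec_of_ne hG hψ (ne_of_mem_of_not_mem hx hE)

theorem spectralProj_mulVec_self (hG : G.IsHermitian) (hψ : G *ᵥ ψ = (E : ℂ) • ψ) :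
    spectralProj G E *ᵥ ψ = ψ := by
  rcases eq_or_ne ψ 0 with rfl | h0
  · exact mulVec_zero _
  · conv_rhs => rw [← one_mulVec ψ, ← sum_spectralProj hG, sum_mulVec]
    exact (Finset.sum_eq_single_of_mem E (mem_realSpectrum_of_mulVec_eq hG hψ h0) fun x _ hx =>
      spectralProj_mulVec_of_ne hG hψ hx).symm

/-- The normalised vector `ψ` spans the eigenspace of `G` at the energy `E`. -/
structure IsSimpleEigenvector (G : Matrix n n ℂ) (E : ℝ) (ψ : n → ℂ) : Prop where
  unit : star ψ ⬝ᵥ ψ = 1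
  mulVec_eq : G *ᵥ ψ = (E : ℂ) • ψ
  exists_eq_smul : ∀ φ : n → ℂ, G *ᵥ φ = (E : ℂ) • φ → ∃ z : ℂ, φ = z • ψ

theorem IsSimpleEigenvector.mem_realSpectrum (hψ : IsSimpleEigenvector G E ψ)
    (hG : G.IsHermitian) : E ∈ realSpectrum G :=
  mem_realSpectrum_of_mulVec_eq hG hψ.mulVec_eq fun h => by simpa [h] using hψ.unit

theorem IsSimpleEigenvector.spectralProj_eq (hψ : IsSimpleEigenvector G E ψ)
    (hG : G.IsHermitian) : spectralProj G E = vecMulVec ψ (star ψ) := by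
  refine Matrix.ext_iff_mulVec.2 fun v => ?_
  obtain ⟨z, hz⟩ := hψ.exists_eq_smul (spectralProj G E *ᵥ v) (by
    rw [mulVec_mulVec, mul_spectralProj hG, smul_mulVec])
  have hzv : z = star ψ ⬝ᵥ v := by
    calc z = star ψ ⬝ᵥ (spectralProj G E *ᵥ v) := by
          rw [hz, dotProduct_smul, hψ.unit, smul_eq_mul, mul_one]
      _ = star (spectralProj G E *ᵥ ψ) ⬝ᵥ v := by
          rw [dotProduct_mulVec, star_mulVec, (isHermitian_spectralProj G E).eq]
      _ = star ψ ⬝ᵥ v := by rw [spectralProj_mulVec_self hG hψ.mulVec_eq]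
  rw [hz, vecMulVec_mulVec, hzv, op_smul_eq_smul]

theorem exists_eq_smul_eigenvectorBasis (hG : G.IsHermitian)
    (hinj : Function.Injective hG.eigenvalues) {k : n}
    (hψ : G *ᵥ ψ = (hG.eigenvalues k : ℂ) • ψ) :
    ∃ z : ℂ, ψ = z • ⇑(hG.eigenvectorBasis k) := by
  have hcoeff {j : n} (hj : j ≠ k) :
      inner ℂ (hG.eigenvectorBasis j) (WithLp.toLp 2 ψ) = 0 := by
    have hfix := spectralProj_mulVec_self (E := hG.eigenvalues j) hG
      (hG.mulVec_eigenvectorBasis j)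
    rw [EuclideanSpace.inner_eq_star_dotProduct, dotProduct_comm, ← hfix, star_mulVec,
      (isHermitian_spectralProj G _).eq, ← dotProduct_mulVec,
      spectralProj_mulVec_of_ne hG hψ (hinj.ne hj), dotProduct_zero]
  refine ⟨inner ℂ (hG.eigenvectorBasis k) (WithLp.toLp 2 ψ), ?_⟩
  have hsum := hG.eigenvectorBasis.sum_repr' (WithLp.toLp 2 ψ)
  rw [Finset.sum_eq_single_of_mem k (Finset.mem_univ k) fun j _ hj => by
    rw [hcoeff hj, zero_smul]] at hsum
  exact (congrArg WithLp.ofLp hsum).symm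

theorem isSimpleEigenvector_of_injective_eigenvalues (hG : G.IsHermitian)
    (hinj : Function.Injective hG.eigenvalues) (hunit : star ψ ⬝ᵥ ψ = 1)
    (hψ : G *ᵥ ψ = (E : ℂ) • ψ) : IsSimpleEigenvector G E ψ := by
  have hψ₀ : ψ ≠ 0 := fun h => by simp [h] at hunit
  obtain ⟨k, rfl⟩ : ∃ k, hG.eigenvalues k = E := by
    have hE := mem_realSpectrum.1 (mem_realSpectrum_of_mulVec_eq hG hψ hψ₀)
    rwa [hG.spectrum_real_eq_range_eigenvalues] at hE
  obtain ⟨w, hw⟩ := exists_eq_smul_eigenvectorBasis hG hinj hψ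
  have hw₀ : w ≠ 0 := fun h => hψ₀ (by rw [hw, h, zero_smul])
  refine ⟨hunit, hψ, fun φ hφ => ?_⟩
  obtain ⟨z, hz⟩ := exists_eq_smul_eigenvectorBasis hG hinj hφ
  exact ⟨z * w⁻¹, by rw [hz, hw, smul_smul, inv_mul_cancel_right₀ hw₀]⟩

end Spectral

section TimeMean

open MeasureTheory Filter Topology

/-- The continuous function `f` has the limit `m` of its averages over `[0, T]`. -/
def HasTimeMean {F : Type*} [NormedAddCommGroup F] [NormedSpace ℝ F] (f : ℝ → F) (m : F) : Prop :=
  Continuous f ∧ Tendsto (fun T : ℝ => T⁻¹ • ∫ t in (0 : ℝ)..T, f t) atTop (𝓝 m)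

namespace HasTimeMean

section Real

variable {F F' : Type*} [NormedAddCommGroup F] [NormedSpace ℝ F] [NormedAddCommGroup F']
  [NormedSpace ℝ F'] {f g : ℝ → F} {m m' : F}

theorem sub (hf : HasTimeMean f m) (hg : HasTimeMean g m') :
    HasTimeMean (fun t => f t - g t) (m - m') := by
  refine ⟨hf.1.sub hg.1, (hf.2.sub hg.2).congr fun T => ?_⟩
  rw [intervalIntegral.integral_sub (hf.1.intervalIntegrable _ _) (hg.1.intervalIntegrable _ _),
    smul_sub]

theorem sum {ι : Type*} {s : Finset ι} {f : ι → ℝ → F} {m : ι → F}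
    (h : ∀ i ∈ s, HasTimeMean (f i) (m i)) :
    HasTimeMean (fun t => ∑ i ∈ s, f i t) (∑ i ∈ s, m i) := by
  refine ⟨continuous_finsetSum _ fun i hi => (h i hi).1,
    (tendsto_finsetSum _ fun i hi => (h i hi).2).congr fun T => ?_⟩
  rw [intervalIntegral.integral_finsetSum fun i hi => (h i hi).1.intervalIntegrable _ _,
    Finset.smul_sum]

theorem norm_le (hf : HasTimeMean f m) {C : ℝ} (hC : ∀ t, 0 ≤ t → ‖f t‖ ≤ C) : ‖m‖ ≤ C := by
  refine le_of_tendsto hf.2.norm ?_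
  filter_upwards [eventually_gt_atTop 0] with T hT
  have h := intervalIntegral.norm_integral_le_of_norm_le_const (a := 0) (b := T) (C := C) (f := f)
    fun t ht => hC t (by rw [Set.uIoc_of_le hT.le] at ht; exact ht.1.le)
  rw [sub_zero, abs_of_pos hT] at h
  rwa [norm_smul, norm_inv, Real.norm_of_nonneg hT.le, inv_mul_le_iff₀ hT, mul_comm]

theorem clm [CompleteSpace F] [CompleteSpace F'] (hf : HasTimeMean f m) (L : F →L[ℝ] F') :
    HasTimeMean (fun t => L (f t)) (L m) := by
  refine ⟨L.continuous.comp hf.1, ((L.continuous.tendsto m).comp hf.2).congr fun T => ?_⟩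
  rw [L.intervalIntegral_comp_comm (hf.1.intervalIntegrable _ _), Function.comp_apply, map_smul]

theorem const [CompleteSpace F] (m : F) : HasTimeMean (fun _ => m) m := by
  refine ⟨continuous_const, tendsto_const_nhds.congr' ?_⟩
  filter_upwards [eventually_gt_atTop 0] with T hT
  rw [intervalIntegral.integral_const, sub_zero, smul_smul, inv_mul_cancel₀ hT.ne', one_smul]

end Real

theorem cexp_of_ne_zero {ω : ℝ} (hω : ω ≠ 0) :
    HasTimeMean (fun t : ℝ => Complex.exp (Complex.I * ω * t)) 0 := by
  have hnorm (t : ℝ) : ‖Complex.exp (Complex.I * ω * t)‖ = 1 := by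
    simp [Complex.norm_exp]
  refine ⟨by fun_prop, squeeze_zero_norm' (a := fun T : ℝ => T⁻¹ * (2 / |ω|)) ?_ ?_⟩
  · filter_upwards [eventually_gt_atTop 0] with T hT
    have hc : Complex.I * (ω : ℂ) ≠ 0 := by simp [hω]
    have h2 : ‖Complex.exp (Complex.I * ω * T) - Complex.exp (Complex.I * ω * (0 : ℝ))‖ ≤ 2 :=
      (norm_sub_le _ _).trans_eq (by rw [hnorm, hnorm]; norm_num)
    rw [integral_exp_mul_complex hc, norm_smul, norm_inv, Real.norm_of_nonneg hT.le, norm_div,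
      norm_mul, Complex.norm_I, one_mul, Complex.norm_real, Real.norm_eq_abs]
    gcongr
  · simpa using tendsto_inv_atTop_zero.mul_const (2 / |ω|)

variable {ι κ F : Type*} {s : Finset ι} {u : Finset κ} {ω : ι → ℝ} {ν : κ → ℝ}

theorem cexp_smul [NormedAddCommGroup F] [NormedSpace ℂ F] [CompleteSpace F] (ω : ℝ) (M : F) :
    HasTimeMean (fun t : ℝ => Complex.exp (Complex.I * ω * t) • M) (if ω = 0 then M else 0) := by
  split_ifs with hω
  · simpa [hω] using const M
  · simpa using (cexp_of_ne_zero hω).clm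
      ((ContinuousLinearMap.toSpanSingleton ℂ M).restrictScalars ℝ)

theorem sum_cexp_smul [NormedAddCommGroup F] [NormedSpace ℂ F] [CompleteSpace F] (s : Finset ι)
    (ω : ι → ℝ) (M : ι → F) :
    HasTimeMean (fun t : ℝ => ∑ i ∈ s, Complex.exp (Complex.I * ω i * t) • M i)
      (∑ i ∈ s with ω i = 0, M i) := by
  rw [Finset.sum_filter]
  exact sum fun i _ => cexp_smul (ω i) (M i)

theorem sum_cexp_smul_mul_sum_cexp_smul [NormedRing F] [NormedAlgebra ℂ F] [CompleteSpace F]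
    (h : ∀ i ∈ s, ∀ j ∈ u, ω i + ν j = 0 → ω i = 0) (M : ι → F) (N : κ → F) :
    HasTimeMean (fun t : ℝ => (∑ i ∈ s, Complex.exp (Complex.I * ω i * t) • M i) *
        ∑ j ∈ u, Complex.exp (Complex.I * ν j * t) • N j)
      ((∑ i ∈ s with ω i = 0, M i) * ∑ j ∈ u with ν j = 0, N j) := by
  have hprod (t : ℝ) :
      (∑ i ∈ s, Complex.exp (Complex.I * ω i * t) • M i) *
          ∑ j ∈ u, Complex.exp (Complex.I * ν j * t) • N j =
        ∑ p ∈ s ×ˢ u, Complex.exp (Complex.I * (ω p.1 + ν p.2 : ℝ) * t) • (M p.1 * N p.2) := by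
    rw [Finset.sum_mul_sum, ← Finset.sum_product']
    refine Finset.sum_congr rfl fun p _ => ?_
    rw [smul_mul_smul_comm, ← Complex.exp_add, Complex.ofReal_add, mul_add, add_mul]
  have hmean : (∑ i ∈ s with ω i = 0, M i) * ∑ j ∈ u with ν j = 0, N j =
      ∑ p ∈ s ×ˢ u with ω p.1 + ν p.2 = 0, M p.1 * N p.2 := by
    rw [Finset.sum_mul_sum, ← Finset.sum_product', ← Finset.filter_product]
    refine Finset.sum_congr (Finset.filter_congr fun p hp => ?_) fun _ _ => rfl
    obtain ⟨hp₁, hp₂⟩ := Finset.mem_product.1 hp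
    refine ⟨fun ⟨h₁, h₂⟩ => by rw [h₁, h₂, add_zero], fun h₀ => ?_⟩
    have h₁ := h p.1 hp₁ p.2 hp₂ h₀
    exact ⟨h₁, by simpa [h₁] using h₀⟩
  simp only [hprod, hmean]
  exact sum_cexp_smul _ (fun p : ι × κ => ω p.1 + ν p.2) fun p => M p.1 * N p.2

end HasTimeMean

end TimeMean

namespace SpinLattice

open Matrix

section Dynamics

variable {S : Type*} [Fintype S] [DecidableEq S] {q : ℕ} {G : Op S q} {ψ : Conf S q → ℂ} {E : ℝ}

theorem heisenberg_eq_sum (hG : G.IsHermitian) (t : ℝ) (A : Op S q) :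
    heisenberg G t A = ∑ p ∈ realSpectrum G ×ˢ realSpectrum G,
      Complex.exp (Complex.I * (p.1 - p.2 : ℝ) * t) •
        (spectralProj G p.1 * A * spectralProj G p.2) := by
  rw [heisenberg, exp_smul_eq_sum hG, exp_smul_eq_sum hG, Finset.sum_mul, Finset.sum_mul_sum,
    ← Finset.sum_product']
  refine Finset.sum_congr rfl fun p _ => ?_
  rw [smul_mul_assoc, smul_mul_smul_comm, ← Complex.exp_add]
  congr 2
  push_cast
  ring

theorem exp_mem_unitary (hG : G.IsHermitian) (t : ℝ) :
    NormedSpace.exp ((Complex.I * (t : ℂ)) • G) ∈ unitary (Op S q) := by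
  let _ : NormedAlgebra ℚ (Op S q) := NormedAlgebra.restrictScalars ℚ ℂ (Op S q)
  refine NormedSpace.exp_mem_unitary_of_mem_skewAdjoint ?_
  rw [skewAdjoint.mem_iff, star_smul, star_eq_conjTranspose, hG.eq]
  simp

theorem star_exp (hG : G.IsHermitian) (t : ℝ) :
    star (NormedSpace.exp ((Complex.I * (t : ℂ)) • G))
      = NormedSpace.exp (-(Complex.I * (t : ℂ)) • G) := by
  rw [NormedSpace.star_exp, star_smul, star_eq_conjTranspose, hG.eq]
  simp

theorem norm_heisenberg (hG : G.IsHermitian) (t : ℝ) (A : Op S q) : ‖heisenberg G t A‖ = ‖A‖ := by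
  have h := exp_mem_unitary hG t
  rw [heisenberg, ← star_exp hG, CStarRing.norm_mul_mem_unitary _ (Unitary.star_mem h),
    CStarRing.norm_mem_unitary_mul _ h]

theorem heisenberg_mul (hG : G.IsHermitian) (t : ℝ) (A B : Op S q) :
    heisenberg G t A * heisenberg G t B = heisenberg G t (A * B) := by
  have h := (Unitary.mem_iff.1 (exp_mem_unitary hG t)).1
  simp only [heisenberg, ← star_exp hG, mul_assoc]
  rw [← mul_assoc (star _) _ (B * _), h, one_mul]

/-- The time average of the Heisenberg evolution of `A`: the part of `A` which is block diagonal
in the eigenspaces of `G`. -/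
noncomputable def dephasing (G A : Op S q) : Op S q :=
  ∑ x ∈ realSpectrum G, spectralProj G x * A * spectralProj G x

theorem sum_filter_sub_eq_zero_spectralProj (G A : Op S q) :
    ∑ p ∈ realSpectrum G ×ˢ realSpectrum G with p.1 - p.2 = 0,
      spectralProj G p.1 * A * spectralProj G p.2 = dephasing G A := by
  simp [Finset.sum_filter, Finset.sum_product, sub_eq_zero, dephasing]

theorem hasTimeMean_heisenberg (hG : G.IsHermitian) (A : Op S q) :
    HasTimeMean (fun t => heisenberg G t A) (dephasing G A) := by
  simp only [heisenberg_eq_sum hG, ← sum_filter_sub_eq_zero_spectralProj]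
  exact .sum_cexp_smul _ (fun p : ℝ × ℝ => p.1 - p.2) _

theorem norm_dephasing_le (hG : G.IsHermitian) (A : Op S q) : ‖dephasing G A‖ ≤ ‖A‖ :=
  (hasTimeMean_heisenberg hG A).norm_le fun t _ => (norm_heisenberg hG t A).le

theorem hasTimeMean_heisenberg_mul_heisenberg {G₁ G₂ : Op S q} (hG₁ : G₁.IsHermitian)
    (hG₂ : G₂.IsHermitian)
    (hgap : ∀ a ∈ realSpectrum G₁, ∀ a' ∈ realSpectrum G₁, ∀ b ∈ realSpectrum G₂,
      ∀ b' ∈ realSpectrum G₂, a - a' = b - b' → a = a') (A B : Op S q) :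
    HasTimeMean (fun t => heisenberg G₁ t A * heisenberg G₂ t B)
      (dephasing G₁ A * dephasing G₂ B) := by
  simp only [heisenberg_eq_sum hG₁, heisenberg_eq_sum hG₂, ← sum_filter_sub_eq_zero_spectralProj]
  refine .sum_cexp_smul_mul_sum_cexp_smul (ω := fun p : ℝ × ℝ => p.1 - p.2)
    (ν := fun p : ℝ × ℝ => p.1 - p.2) (fun p hp r hr h => ?_) _ _
  rw [Finset.mem_product] at hp hr
  exact sub_eq_zero.2 (hgap p.1 hp.1 p.2 hp.2 r.2 hr.2 r.1 hr.1 (by linarith))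

/-- The expectation value in the state `ψ` as a linear functional. -/
def expectationLin (ψ : Conf S q → ℂ) : Op S q →ₗ[ℂ] ℂ where
  toFun := expectation ψ
  map_add' A B := by simp [expectation, add_mulVec]
  map_smul' c A := by simp [expectation, smul_mulVec]

theorem expectationLin_apply (ψ : Conf S q → ℂ) (A : Op S q) :
    expectationLin ψ A = expectation ψ A := rfl

theorem expectation_conjTranspose (ψ : Conf S q → ℂ) (A : Op S q) :
    expectation ψ Aᴴ = star (expectation ψ A) := by
  rw [expectation, expectation, ← star_dotProduct_star, star_star, star_mulVec, dotProduct_mulVec]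

theorem norm_expectation_le (hψ : IsUnitVector ψ) (A : Op S q) : ‖expectation ψ A‖ ≤ ‖A‖ := by
  have hinner (φ : Conf S q → ℂ) :
      star ψ ⬝ᵥ φ = inner ℂ (WithLp.toLp 2 ψ) (WithLp.toLp 2 φ) := by
    rw [EuclideanSpace.inner_toLp_toLp, dotProduct_comm]
  have hnorm : ‖WithLp.toLp 2 ψ‖ = 1 := by
    have h : (‖WithLp.toLp 2 ψ‖ : ℂ) ^ 2 = 1 := by
      rw [← hψ, hinner]
      exact (inner_self_eq_norm_sq_to_K (𝕜 := ℂ) (WithLp.toLp 2 ψ)).symm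
    exact (pow_eq_one_iff_of_nonneg (norm_nonneg _) two_ne_zero).1 (mod_cast h)
  calc ‖expectation ψ A‖ ≤ ‖WithLp.toLp 2 ψ‖ * ‖WithLp.toLp 2 (A *ᵥ ψ)‖ := by
        rw [expectation, hinner]
        exact norm_inner_le_norm _ _
    _ ≤ ‖A‖ := by simpa [hnorm] using A.l2_opNorm_mulVec (WithLp.toLp 2 ψ)

theorem exp_mulVec (hG : G.IsHermitian) (hψ : G *ᵥ ψ = (E : ℂ) • ψ) (z : ℂ) :
    NormedSpace.exp (z • G) *ᵥ ψ = Complex.exp (z * E) • ψ := by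
  conv_lhs => rw [← spectralProj_mulVec_self hG hψ]
  rw [mulVec_mulVec, exp_mul_of_mul_eq_smul (c := z * E), smul_mulVec,
    spectralProj_mulVec_self hG hψ]
  rw [smul_mul_assoc, mul_spectralProj hG, smul_smul]

theorem expectation_exp_mul (hG : G.IsHermitian) (hψ : G *ᵥ ψ = (E : ℂ) • ψ) (t : ℝ)
    (A : Op S q) :
    expectation ψ (NormedSpace.exp ((Complex.I * t) • G) * A) =
      Complex.exp (Complex.I * t * E) * expectation ψ A := by
  have hleft : star ψ ᵥ* NormedSpace.exp ((Complex.I * t) • G) =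
      Complex.exp (Complex.I * t * E) • star ψ := by
    rw [← star_star (NormedSpace.exp _), star_exp hG, star_eq_conjTranspose, ← star_mulVec,
      exp_mulVec hG hψ, star_smul, ← starRingEnd_apply, ← Complex.exp_conj]
    simp
  rw [expectation, ← mulVec_mulVec, dotProduct_mulVec, hleft, smul_dotProduct, smul_eq_mul]
  rfl

theorem expectation_mul_exp (hG : G.IsHermitian) (hψ : G *ᵥ ψ = (E : ℂ) • ψ) (z : ℂ)
    (A : Op S q) :
    expectation ψ (A * NormedSpace.exp (z • G)) = Complex.exp (z * E) * expectation ψ A := by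
  rw [expectation, ← mulVec_mulVec, exp_mulVec hG hψ, mulVec_smul, dotProduct_smul, smul_eq_mul]
  rfl

theorem expectation_heisenberg (hG : G.IsHermitian) (hψ : G *ᵥ ψ = (E : ℂ) • ψ) (t : ℝ)
    (A : Op S q) : expectation ψ (heisenberg G t A) = expectation ψ A := by
  rw [heisenberg, expectation_mul_exp hG hψ, expectation_exp_mul hG hψ, ← mul_assoc,
    ← Complex.exp_add]
  simp

theorem heisenberg_heisenberg_neg (hG : G.IsHermitian) (t : ℝ) (A : Op S q) :
    heisenberg G t (heisenberg G (-t) A) = A := by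
  obtain ⟨-, h⟩ := Unitary.mem_iff.1 (exp_mem_unitary hG t)
  rw [star_exp hG] at h
  simp only [heisenberg, Complex.ofReal_neg, mul_neg, neg_neg, mul_assoc, h, mul_one]
  rw [← mul_assoc, h, one_mul]

theorem expectation_heisenberg_mul (hG : G.IsHermitian) (hψ : G *ᵥ ψ = (E : ℂ) • ψ) (t : ℝ)
    (A B : Op S q) :
    expectation ψ (heisenberg G t A * B) = expectation ψ (A * heisenberg G (-t) B) := by
  rw [← expectation_heisenberg hG hψ t (A * _), ← heisenberg_mul hG,
    heisenberg_heisenberg_neg hG]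

theorem expectation_mul_heisenberg (hG : G.IsHermitian) (hψ : G *ᵥ ψ = (E : ℂ) • ψ) (t : ℝ)
    (A B : Op S q) :
    expectation ψ (A * heisenberg G t B) = ∑ x ∈ realSpectrum G,
      Complex.exp (Complex.I * (x - E : ℝ) * t) • expectation ψ (A * spectralProj G x * B) := by
  rw [heisenberg, ← mul_assoc, expectation_mul_exp hG hψ, exp_smul_eq_sum hG, Finset.sum_mul,
    Finset.mul_sum, ← expectationLin_apply, map_sum, Finset.mul_sum]
  refine Finset.sum_congr rfl fun x _ => ?_
  rw [smul_mul_assoc, mul_smul_comm, map_smul, expectationLin_apply, smul_eq_mul, smul_eq_mul,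
    ← mul_assoc, ← mul_assoc, ← Complex.exp_add]
  congr 2
  push_cast
  ring

theorem isHermitian_heisenberg (hG : G.IsHermitian) (t : ℝ) {A : Op S q}
    (hA : A.IsHermitian) : (heisenberg G t A).IsHermitian := by
  rw [heisenberg, ← star_exp hG]
  exact isHermitian_mul_mul_conjTranspose _ hA

theorem expectation_im (ψ : Conf S q → ℂ) {A : Op S q} (hA : A.IsHermitian) :
    (expectation ψ A).im = 0 := by
  rw [← Complex.conj_eq_iff_im, starRingEnd_apply, ← expectation_conjTranspose, hA.eq]

theorem norm_expectation_commutator (ψ : Conf S q → ℂ) {A B : Op S q} (hA : A.IsHermitian)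
    (hB : B.IsHermitian) :
    ‖expectation ψ (A * B - B * A)‖ = 2 * |(expectation ψ (A * B)).im| := by
  have hconj : expectation ψ (B * A) = starRingEnd ℂ (expectation ψ (A * B)) := by
    rw [starRingEnd_apply, ← expectation_conjTranspose, conjTranspose_mul, hA.eq, hB.eq]
  rw [← expectationLin_apply, map_sub, expectationLin_apply, expectationLin_apply, hconj,
    Complex.sub_conj]
  simp

theorem expectation_mul_vecMulVec_mul (ψ : Conf S q → ℂ) (A B : Op S q) :
    expectation ψ (A * vecMulVec ψ (star ψ) * B) = expectation ψ A * expectation ψ B := by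
  simp only [expectation, ← mulVec_mulVec, vecMulVec_mulVec, mulVec_smul, op_smul_eq_smul,
    dotProduct_smul, smul_eq_mul, mul_comm]

/-- The correlation `⟨ψ|AB|ψ⟩ - ⟨ψ|A|ψ⟩⟨ψ|B|ψ⟩` of two observables in the state `ψ`. -/
def correlation (ψ : Conf S q → ℂ) (A B : Op S q) : ℂ :=
  expectation ψ (A * B) - expectation ψ A * expectation ψ B

end Dynamics

end SpinLattice

namespace SpinLattice

open Matrix Filter Topology Kronecker

section Dephasing

variable {S : Type*} [Fintype S] [DecidableEq S] {q : ℕ} {G G₁ G₂ A B : Op S q}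
  {ψ : Conf S q → ℂ} {E δ : ℝ}

theorem dephasing_mulVec (hG : G.IsHermitian) (hψ : IsSimpleEigenvector G E ψ) (A : Op S q) :
    dephasing G A *ᵥ ψ = expectation ψ A • ψ := by
  rw [dephasing, sum_mulVec, Finset.sum_eq_single_of_mem E (hψ.mem_realSpectrum hG)]
  · rw [← mulVec_mulVec, spectralProj_mulVec_self hG hψ.mulVec_eq, ← mulVec_mulVec,
      hψ.spectralProj_eq hG, vecMulVec_mulVec, op_smul_eq_smul, expectation]
  · intro x _ hx
    rw [← mulVec_mulVec, spectralProj_mulVec_of_ne hG hψ.mulVec_eq hx, mulVec_zero]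

theorem expectation_dephasing_mul_dephasing (hG : G.IsHermitian)
    (hψ : IsSimpleEigenvector G E ψ) (A B : Op S q) :
    expectation ψ (dephasing G A * dephasing G B) = expectation ψ A * expectation ψ B := by
  rw [expectation, ← mulVec_mulVec, dephasing_mulVec hG hψ, mulVec_smul, dephasing_mulVec hG hψ,
    dotProduct_smul, dotProduct_smul, hψ.unit, smul_eq_mul, smul_eq_mul, mul_one, mul_comm]

theorem norm_mul_sub_mul_le {F : Type*} [NormedRing F] {A A' B B' : F} {δ : ℝ}
    (hA : ‖A - A'‖ ≤ δ) (hB : ‖B - B'‖ ≤ δ) (hA' : ‖A'‖ ≤ 1) (hB₁ : ‖B‖ ≤ 1) :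
    ‖A * B - A' * B'‖ ≤ 2 * δ := by
  have hδ : 0 ≤ δ := (norm_nonneg _).trans hA
  calc ‖A * B - A' * B'‖ = ‖(A - A') * B + A' * (B - B')‖ := by
        rw [sub_mul, mul_sub, sub_add_sub_cancel]
    _ ≤ ‖A - A'‖ * ‖B‖ + ‖A'‖ * ‖B - B'‖ := norm_add_le_of_le (norm_mul_le _ _) (norm_mul_le _ _)
    _ ≤ δ * 1 + 1 * δ := by gcongr
    _ = 2 * δ := by ring

theorem norm_expectation_mul_sub_le (hG : G.IsHermitian) (hG₁ : G₁.IsHermitian)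
    (hG₂ : G₂.IsHermitian)
    (hgap : ∀ a ∈ realSpectrum G₁, ∀ a' ∈ realSpectrum G₁, ∀ b ∈ realSpectrum G₂,
      ∀ b' ∈ realSpectrum G₂, a - a' = b - b' → a = a')
    (hunit : IsUnitVector ψ) (hψ : G *ᵥ ψ = (E : ℂ) • ψ) (hA : ‖A‖ ≤ 1) (hB : ‖B‖ ≤ 1)
    (hAδ : ∀ t : ℝ, 0 ≤ t → ‖heisenberg G t A - heisenberg G₁ t A‖ ≤ δ)
    (hBδ : ∀ t : ℝ, 0 ≤ t → ‖heisenberg G t B - heisenberg G₂ t B‖ ≤ δ) :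
    ‖expectation ψ (A * B) - expectation ψ (dephasing G₁ A * dephasing G₂ B)‖ ≤ 2 * δ := by
  have hmean := (hasTimeMean_heisenberg_mul_heisenberg hG₁ hG₂ hgap A B).clm
    ((expectationLin ψ).toContinuousLinearMap.restrictScalars ℝ)
  refine ((HasTimeMean.const (expectation ψ (A * B))).sub hmean).norm_le fun t ht => ?_
  have hconserved : expectation ψ (A * B) =
      expectation ψ (heisenberg G t A * heisenberg G t B) := by
    rw [heisenberg_mul hG, expectation_heisenberg hG hψ]
  calc _ = ‖expectation ψ (heisenberg G t A * heisenberg G t B -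
          heisenberg G₁ t A * heisenberg G₂ t B)‖ := by
        rw [hconserved]
        exact congrArg _ (map_sub (expectationLin ψ) _ _).symm
    _ ≤ _ := norm_expectation_le hunit _
    _ ≤ 2 * δ := norm_mul_sub_mul_le (hAδ t ht) (hBδ t ht)
        ((norm_heisenberg hG₁ t A).trans_le hA) ((norm_heisenberg hG t B).trans_le hB)

theorem norm_dephasing_mul_sub_le (hG : G.IsHermitian) (hG₁ : G₁.IsHermitian)
    (hG₂ : G₂.IsHermitian) (hA : ‖A‖ ≤ 1) (hB : ‖B‖ ≤ 1)
    (hAδ : ∀ t : ℝ, 0 ≤ t → ‖heisenberg G t A - heisenberg G₁ t A‖ ≤ δ)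
    (hBδ : ∀ t : ℝ, 0 ≤ t → ‖heisenberg G t B - heisenberg G₂ t B‖ ≤ δ) :
    ‖dephasing G A * dephasing G B - dephasing G₁ A * dephasing G₂ B‖ ≤ 2 * δ :=
  norm_mul_sub_mul_le
    (((hasTimeMean_heisenberg hG A).sub (hasTimeMean_heisenberg hG₁ A)).norm_le hAδ)
    (((hasTimeMean_heisenberg hG B).sub (hasTimeMean_heisenberg hG₂ B)).norm_le hBδ)
    ((norm_dephasing_le hG₁ A).trans hA) ((norm_dephasing_le hG B).trans hB)

theorem norm_correlation_le_of_norm_heisenberg_sub_le (hG : G.IsHermitian)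
    (hG₁ : G₁.IsHermitian) (hG₂ : G₂.IsHermitian)
    (hgap : ∀ a ∈ realSpectrum G₁, ∀ a' ∈ realSpectrum G₁, ∀ b ∈ realSpectrum G₂,
      ∀ b' ∈ realSpectrum G₂, a - a' = b - b' → a = a')
    (hψ : IsSimpleEigenvector G E ψ) (hA : ‖A‖ ≤ 1) (hB : ‖B‖ ≤ 1)
    (hAδ : ∀ t : ℝ, 0 ≤ t → ‖heisenberg G t A - heisenberg G₁ t A‖ ≤ δ)
    (hBδ : ∀ t : ℝ, 0 ≤ t → ‖heisenberg G t B - heisenberg G₂ t B‖ ≤ δ) :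
    ‖correlation ψ A B‖ ≤ 4 * δ := by
  have hlocal := norm_expectation_mul_sub_le hG hG₁ hG₂ hgap hψ.unit hψ.mulVec_eq hA hB hAδ hBδ
  have hglobal : ‖expectation ψ (dephasing G₁ A * dephasing G₂ B) -
      expectation ψ A * expectation ψ B‖ ≤ 2 * δ := by
    rw [norm_sub_rev, ← expectation_dephasing_mul_dephasing hG hψ, ← expectationLin_apply,
      ← expectationLin_apply, ← map_sub]
    exact (norm_expectation_le hψ.unit _).trans
      (norm_dephasing_mul_sub_le hG hG₁ hG₂ hA hB hAδ hBδ)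
  calc ‖correlation ψ A B‖ ≤ _ := norm_sub_le_norm_sub_add_norm_sub _ _ _
    _ ≤ 2 * δ + 2 * δ := add_le_add hlocal hglobal
    _ = 4 * δ := by ring

end Dephasing

section Region

theorem embed_embed {S T W : Type*} {q : ℕ} {f : S → T} {g : T → W} (hg : Function.Injective g)
    (M : Op S q) : embed g (embed f M) = embed (g ∘ f) M := by
  ext σ τ
  have hiff : (∀ x, x ∉ Set.range (g ∘ f) → σ x = τ x) ↔
      (∀ x, x ∉ Set.range g → σ x = τ x) ∧
        ∀ y, y ∉ Set.range f → (σ ∘ g) y = (τ ∘ g) y := by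
    refine ⟨fun h => ⟨fun x hx => h x fun ⟨s, hs⟩ => hx ⟨f s, hs⟩,
      fun y hy => h (g y) fun ⟨s, hs⟩ => hy ⟨s, hg hs⟩⟩, fun ⟨hout, hin⟩ x hx => ?_⟩
    by_cases hx' : x ∈ Set.range g
    · obtain ⟨y, rfl⟩ := hx'
      exact hin y fun ⟨s, hs⟩ => hx ⟨s, congrArg g hs⟩
    · exact hout x hx'
  classical
  exact ((if_congr hiff rfl rfl).trans (ite_and ..)).symm

variable {V : Type*} [Fintype V] [DecidableEq V] {q : ℕ} (R : Finset V)

theorem embed_val_eq_kronecker (M : Op R q) : embed (Subtype.val : R → V) M =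
    (M ⊗ₖ (1 : Matrix ({x // x ∉ R} → Fin q) ({x // x ∉ R} → Fin q) ℂ)).submatrix
      (Equiv.piEquivPiSubtypeProd (· ∈ R) fun _ => Fin q)
      (Equiv.piEquivPiSubtypeProd (· ∈ R) fun _ => Fin q) := by
  classical
  ext σ τ
  have hiff : (∀ x, x ∉ Set.range (Subtype.val : R → V) → σ x = τ x) ↔
      (fun x : {x // x ∉ R} => σ x.1) = (fun x : {x // x ∉ R} => τ x.1) := by
    simp [funext_iff]
  change _ = M (σ ∘ Subtype.val) (τ ∘ Subtype.val) *
    (1 : Matrix ({x // x ∉ R} → Fin q) ({x // x ∉ R} → Fin q) ℂ)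
      (fun x => σ x.1) (fun x => τ x.1)
  rw [one_apply, mul_ite, mul_one, mul_zero, embed]
  congr 1
  exact propext hiff

/-- The embedding `M ↦ M ⊗ 1` of the operators on a region as a homomorphism of algebras. -/
noncomputable def embedHom : Op R q →ₐ[ℂ] Op V q :=
  AlgHom.ofLinearMap
    { toFun := embed (Subtype.val : R → V)
      map_add' M N := by simp only [embed_val_eq_kronecker, add_kronecker, submatrix_add]; rfl
      map_smul' c M := by simp only [embed_val_eq_kronecker, smul_kronecker, submatrix_smul]; rfl }
    (by simp [embed_val_eq_kronecker])
    (fun M N => by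
      simp only [LinearMap.coe_mk, AddHom.coe_mk, embed_val_eq_kronecker]
      rw [submatrix_mul_equiv, ← mul_kronecker_mul, one_mul])

theorem embedHom_apply (M : Op R q) : embedHom R M = embed (Subtype.val : R → V) M := rfl

namespace LocalHamiltonian

variable {ι : Type*} [Fintype ι] (H : LocalHamiltonian V ι q)

theorem trunc_eq_embedHom : H.trunc R = embedHom R (H.region R) := by
  rw [trunc, region, map_sum, Finset.sum_filter]
  refine Finset.sum_congr rfl fun j _ => ?_
  split_ifs with h
  · rw [embedHom_apply, embed_embed Subtype.val_injective]
    rfl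
  · rw [map_zero]

omit [Fintype V] in
theorem isHermitian_trunc : (H.trunc R).IsHermitian :=
  isSelfAdjoint_sum _ fun j _ => embed_isHermitian _ (H.isHermitian_term j)

theorem exists_regionEnergy_eq {x : ℝ} (hx : x ∈ realSpectrum (H.trunc R)) :
    ∃ a, H.regionEnergy R a = x := by
  have hspec : x ∈ spectrum ℝ (H.region R) := by
    rw [mem_realSpectrum, trunc_eq_embedHom] at hx
    exact AlgHom.spectrum_apply_subset ((embedHom R).restrictScalars ℝ) _ hx
  rwa [(H.region_isHermitian R).spectrum_real_eq_range_eigenvalues] at hspec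

end LocalHamiltonian

end Region

namespace LocalHamiltonian

section Distance

variable {V ι : Type*} {q : ℕ} (H : LocalHamiltonian V ι q) {X Y : Finset V}

theorem dist_comm (X Y : Finset V) : H.dist X Y = H.dist Y X := by
  unfold dist
  rw [iInf₂_comm]
  simp only [SimpleGraph.edist_comm]

theorem one_le_dist (h : Disjoint X Y) : 1 ≤ H.dist X Y := by
  refine le_iInf₂ fun x hx => le_iInf₂ fun y hy => ?_
  rw [Order.one_le_iff_ne_zero, Ne, SimpleGraph.edist_eq_zero_iff]
  rintro rfl
  exact Finset.disjoint_left.1 h hx hy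

variable [Fintype V] [DecidableEq V]

theorem nbhd_eq_halfway_of_finite {n : ℕ} (hn : H.dist X Y = n) {l : ℝ}
    (hl : l ∈ Set.Ico ((n - 1 : ℝ) / 2) (n / 2)) : H.nbhd X l = H.halfway X Y := by
  ext x
  simp only [nbhd, halfway, Finset.mem_filter, Finset.mem_univ, true_and, hn]
  refine exists_congr fun y => and_congr_right fun _ => ?_
  by_cases hr : H.interactionGraph.Reachable y x
  · have hcast : 2 * (H.interactionGraph.dist y x : ℕ∞) < n ↔
        2 * H.interactionGraph.dist y x < n := by norm_cast
    rw [← hr.coe_dist_eq_edist, hcast]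
    refine ⟨fun ⟨_, hle⟩ => ?_, fun hlt => ⟨hr, ?_⟩⟩
    · have : (2 * H.interactionGraph.dist y x : ℝ) < n := by linarith only [hle, hl.2]
      exact_mod_cast this
    · have : (2 * H.interactionGraph.dist y x + 1 : ℝ) ≤ n := mod_cast hlt
      linarith [hl.1]
  · simp [hr, SimpleGraph.edist_eq_top_of_not_reachable hr]

theorem eventually_nbhd_eq_halfway (htop : H.dist X Y = ⊤) :
    ∀ᶠ l : ℝ in atTop, H.nbhd X l = H.halfway X Y := by
  have h : ∀ᶠ l : ℝ in atTop, ∀ y x, (H.interactionGraph.dist y x : ℝ) ≤ l :=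
    eventually_all.2 fun y => eventually_all.2 fun x => eventually_ge_atTop _
  filter_upwards [h] with l hl
  ext x
  simp only [nbhd, halfway, Finset.mem_filter, Finset.mem_univ, true_and, htop, hl, and_true]
  refine exists_congr fun y => and_congr_right fun _ => ?_
  by_cases hr : H.interactionGraph.Reachable y x
  · rw [← hr.coe_dist_eq_edist]
    exact iff_of_true hr (mod_cast ENat.natCast_lt_top _)
  · simp [hr, SimpleGraph.edist_eq_top_of_not_reachable hr]

theorem exists_tendsto_exp_of_dist (hXY : Disjoint X Y) {μ : ℝ} (hμ : 0 < μ) :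
    ∃ F : Filter ℝ, F.NeBot ∧ Tendsto (fun l => Real.exp (-μ * l)) F
        (𝓝 (expDecay (μ / 2) (H.dist X Y))) ∧
      ∀ᶠ l in F, 0 ≤ l ∧ H.nbhd X l = H.halfway X Y ∧ H.nbhd Y l = H.halfway Y X := by
  rw [expDecay]
  split_ifs with htop
  · refine ⟨atTop, inferInstance,
      Real.tendsto_exp_atBot.comp (tendsto_id.const_mul_atTop_of_neg (by linarith)), ?_⟩
    filter_upwards [eventually_ge_atTop 0, H.eventually_nbhd_eq_halfway htop,
      H.eventually_nbhd_eq_halfway ((H.dist_comm Y X).trans htop)] with l hl hX hY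
    exact ⟨hl, hX, hY⟩
  · obtain ⟨n, hn⟩ := ENat.ne_top_iff_exists.1 htop
    have hn1 : (1 : ℝ) ≤ n := by exact_mod_cast hn.symm ▸ H.one_le_dist hXY
    refine ⟨𝓝[<] ((n : ℝ) / 2), inferInstance, ?_, ?_⟩
    · have hval : -(μ / 2) * ((H.dist X Y).toNat : ℝ) = -μ * (n / 2) := by
        rw [← hn, ENat.toNat_natCast]
        ring
      rw [hval]
      exact (Continuous.tendsto (by fun_prop) _).mono_left nhdsWithin_le_nhds
    · filter_upwards [Ico_mem_nhdsLT (show ((n : ℝ) - 1) / 2 < n / 2 by linarith)] with l hl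
      exact ⟨by linarith [hl.1], H.nbhd_eq_halfway_of_finite hn.symm hl,
        H.nbhd_eq_halfway_of_finite ((H.dist_comm Y X).trans hn.symm) hl⟩

end Distance

section Localisation

variable {V ι : Type*} [Fintype V] [DecidableEq V] [Fintype ι] {q : ℕ}
  (H : LocalHamiltonian V ι q) {X Y : Finset V} {A B : Op V q} {ψ : Conf V q → ℂ} {E : ℝ}

theorem norm_correlation_le_of_stronglyLocalised {c μ : ℝ}
    (hloc : H.StrongDynamicalLocalisation c μ) (hXY : Disjoint X Y)
    (hgap : ∀ a a' b b', H.regionEnergy (H.halfway X Y) a - H.regionEnergy (H.halfway X Y) a' =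
      H.regionEnergy (H.halfway Y X) b - H.regionEnergy (H.halfway Y X) b' →
        H.regionEnergy (H.halfway X Y) a = H.regionEnergy (H.halfway X Y) a')
    (hA : IsObservableOn X A) (hB : IsObservableOn Y B) (hψ : IsSimpleEigenvector H.full E ψ) :
    ‖correlation ψ A B‖ ≤ 4 * c * expDecay (μ / 2) (H.dist X Y) := by
  obtain ⟨-, hμ, hlight⟩ := hloc
  obtain ⟨F, hF, hlim, hev⟩ := H.exists_tendsto_exp_of_dist hXY hμ
  refine ge_of_tendsto (hlim.const_mul (4 * c)) (hev.mono fun l ⟨hl, hX, hY⟩ => ?_)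
  rw [mul_assoc]
  refine norm_correlation_le_of_norm_heisenberg_sub_le H.full_isHermitian
    (H.isHermitian_trunc (H.halfway X Y)) (H.isHermitian_trunc (H.halfway Y X)) ?_ hψ hA.2.2.le
    hB.2.2.le (fun t ht => hX ▸ hlight X A hA l hl t ht) fun t ht => hY ▸ hlight Y B hB l hl t ht
  intro x hx x' hx' y hy y' hy' h
  obtain ⟨a, rfl⟩ := H.exists_regionEnergy_eq _ hx
  obtain ⟨a', rfl⟩ := H.exists_regionEnergy_eq _ hx'
  obtain ⟨b, rfl⟩ := H.exists_regionEnergy_eq _ hy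
  obtain ⟨b', rfl⟩ := H.exists_regionEnergy_eq _ hy'
  exact hgap a a' b b' h

end Localisation

end LocalHamiltonian

end SpinLattice

section GaussianFilter

open MeasureTheory Filter Topology Real

/-- The sign function smoothed by a Gaussian of variance `2 α`: the error function of
`ω / (2 √α)`. -/
noncomputable def smoothSign (α ω : ℝ) : ℝ :=
  ∫ s in (0 : ℝ)..ω, rexp (-(4 * α)⁻¹ * s ^ 2) / √(π * α)

theorem smoothSign_neg (α ω : ℝ) : smoothSign α (-ω) = -smoothSign α ω := by
  unfold smoothSign
  have h := intervalIntegral.integral_comp_neg (a := 0) (b := ω)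
    (f := fun s : ℝ => rexp (-(4 * α)⁻¹ * s ^ 2) / √(π * α))
  simp only [neg_sq, neg_zero] at h
  rw [h, intervalIntegral.integral_symm]

variable {α : ℝ}

theorem integral_Ioi_gaussian_div (hα : 0 < α) :
    ∫ s in Set.Ioi (0 : ℝ), rexp (-(4 * α)⁻¹ * s ^ 2) / √(π * α) = 1 := by
  rw [integral_div, integral_gaussian_Ioi, div_inv_eq_mul,
    show π * (4 * α) = 2 ^ 2 * (π * α) by ring, sqrt_mul (by positivity), sqrt_sq (by norm_num)]
  field_simp

theorem integrable_gaussian_div (hα : 0 < α) :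
    Integrable fun s : ℝ => rexp (-(4 * α)⁻¹ * s ^ 2) / √(π * α) :=
  (integrable_exp_neg_mul_sq (by positivity)).div_const _

theorem one_sub_smoothSign (hα : 0 < α) (ω : ℝ) :
    1 - smoothSign α ω = ∫ s in Set.Ioi ω, rexp (-(4 * α)⁻¹ * s ^ 2) / √(π * α) := by
  have h := intervalIntegral.integral_interval_add_Ioi
    (integrable_gaussian_div hα).integrableOn (integrable_gaussian_div hα).integrableOn
    (a := 0) (b := ω) (μ := volume)
  rw [integral_Ioi_gaussian_div hα] at h
  rw [← h, smoothSign, add_sub_cancel_left]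

theorem one_sub_smoothSign_nonneg (hα : 0 < α) (ω : ℝ) : 0 ≤ 1 - smoothSign α ω := by
  rw [one_sub_smoothSign hα]
  exact integral_nonneg fun s => by positivity

theorem one_sub_smoothSign_le (hα : 0 < α) {ω : ℝ} (hω : 0 ≤ ω) :
    1 - smoothSign α ω ≤ rexp (-(4 * α)⁻¹ * ω ^ 2) := by
  have hshift := (measurePreserving_add_right volume ω).setIntegral_preimage_emb
    (measurableEmbedding_addRight ω)
    (fun s : ℝ => rexp (-(4 * α)⁻¹ * s ^ 2) / √(π * α)) (Set.Ioi ω)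
  rw [Set.preimage_add_const_Ioi, sub_self] at hshift
  have hle (s : ℝ) (hs : 0 < s) : rexp (-(4 * α)⁻¹ * (s + ω) ^ 2) / √(π * α) ≤
      rexp (-(4 * α)⁻¹ * ω ^ 2) * (rexp (-(4 * α)⁻¹ * s ^ 2) / √(π * α)) := by
    have hcross : 0 ≤ (4 * α)⁻¹ * (s * ω) := by positivity
    rw [← mul_div_assoc, ← Real.exp_add]
    gcongr
    nlinarith
  calc 1 - smoothSign α ω
      = ∫ s in Set.Ioi (0 : ℝ), rexp (-(4 * α)⁻¹ * (s + ω) ^ 2) / √(π * α) := by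
        rw [one_sub_smoothSign hα, hshift]
    _ ≤ ∫ s in Set.Ioi (0 : ℝ), rexp (-(4 * α)⁻¹ * ω ^ 2) *
          (rexp (-(4 * α)⁻¹ * s ^ 2) / √(π * α)) :=
        setIntegral_mono_on ((integrable_gaussian_div hα).comp_add_right ω).integrableOn
          ((integrable_gaussian_div hα).const_mul _).integrableOn measurableSet_Ioi hle
    _ = rexp (-(4 * α)⁻¹ * ω ^ 2) := by
        rw [integral_const_mul, integral_Ioi_gaussian_div hα, mul_one]

theorem abs_smoothSign_le_one (hα : 0 < α) (ω : ℝ) : |smoothSign α ω| ≤ 1 := by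
  have h1 := one_sub_smoothSign_nonneg hα ω
  have h2 := one_sub_smoothSign_nonneg hα (-ω)
  rw [smoothSign_neg] at h2
  exact abs_le.2 ⟨by linarith, by linarith⟩

theorem integral_cos_mul_gaussian (hα : 0 < α) (ω : ℝ) :
    ∫ t : ℝ, cos (ω * t) * rexp (-α * t ^ 2) = √(π / α) * rexp (-(4 * α)⁻¹ * ω ^ 2) := by
  have hcast : -(ω : ℂ) ^ 2 / (4 * α) = ((-(4 * α)⁻¹ * ω ^ 2 : ℝ) : ℂ) := by
    push_cast
    field_simp
  have hre (t : ℝ) : cos (ω * t) * rexp (-α * t ^ 2) =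
      RCLike.re (Complex.exp (Complex.I * ω * t) * Complex.exp (-(α : ℂ) * t ^ 2)) := by
    rw [show Complex.I * (ω : ℂ) * t = ((ω * t : ℝ) : ℂ) * Complex.I by push_cast; ring,
      show -(α : ℂ) * t ^ 2 = ((-α * t ^ 2 : ℝ) : ℂ) by push_cast; rfl, ← Complex.ofReal_exp,
      RCLike.re_eq_complex_re, Complex.re_mul_ofReal, Complex.exp_ofReal_mul_I_re]
  have hfi : Integrable fun t : ℝ =>
      Complex.exp (Complex.I * ω * t) * Complex.exp (-(α : ℂ) * t ^ 2) := by
    refine (integrable_exp_neg_mul_sq hα).mono' (by fun_prop) (ae_of_all _ fun t => ?_)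
    rw [norm_mul, Complex.norm_exp, Complex.norm_exp]
    simp [← Complex.ofReal_pow]
  simp only [hre]
  rw [integral_re hfi, fourierIntegral_gaussian (by simpa using hα) ω, hcast,
    ← Complex.ofReal_exp, RCLike.re_eq_complex_re, Complex.re_mul_ofReal, sqrt_eq_rpow,
    ← Complex.ofReal_div, show (1 / 2 : ℂ) = ((1 / 2 : ℝ) : ℂ) by push_cast; rfl,
    ← Complex.ofReal_cpow (by positivity), Complex.ofReal_re]

theorem integral_Ioi_cos_mul_gaussian (hα : 0 < α) (ω : ℝ) :
    ∫ t in Set.Ioi (0 : ℝ), cos (ω * t) * rexp (-α * t ^ 2) =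
      π / 2 * (rexp (-(4 * α)⁻¹ * ω ^ 2) / √(π * α)) := by
  have heven (t : ℝ) : cos (ω * |t|) * rexp (-α * |t| ^ 2) = cos (ω * t) * rexp (-α * t ^ 2) := by
    rw [sq_abs, ← cos_abs (ω * |t|), abs_mul, abs_abs, ← abs_mul, cos_abs]
  have hhalf := integral_comp_abs (f := fun t => cos (ω * t) * rexp (-α * t ^ 2))
  simp only [heven] at hhalf
  have hsqrt : √(π / α) = π / √(π * α) := by
    rw [eq_div_iff (by positivity), ← sqrt_mul (by positivity),
      show π / α * (π * α) = π ^ 2 by field_simp, sqrt_sq pi_pos.le]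
  rw [integral_cos_mul_gaussian hα, hsqrt] at hhalf
  linear_combination -hhalf / 2

theorem norm_sin_div_mul_gaussian_le (ω t : ℝ) (α : ℝ) :
    ‖sin (ω * t) / t * rexp (-α * t ^ 2)‖ ≤ |ω| * rexp (-α * t ^ 2) := by
  rw [norm_mul, norm_of_nonneg (Real.exp_pos _).le, norm_div, Real.norm_eq_abs, Real.norm_eq_abs]
  gcongr
  by_cases ht : t = 0
  · simp [ht]
  · rw [div_le_iff₀ (abs_pos.2 ht), ← abs_mul]
    exact abs_sin_le_abs

theorem integrable_sin_div_mul_gaussian (hα : 0 < α) (ω : ℝ) :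
    Integrable fun t : ℝ => sin (ω * t) / t * rexp (-α * t ^ 2) :=
  ((integrable_exp_neg_mul_sq hα).const_mul |ω|).mono'
    (by fun_prop) (ae_of_all _ fun t => norm_sin_div_mul_gaussian_le ω t α)

theorem hasDerivAt_integral_Ioi_sin_div_mul_gaussian (hα : 0 < α) (ω : ℝ) :
    HasDerivAt (fun ω => ∫ t in Set.Ioi (0 : ℝ), sin (ω * t) / t * rexp (-α * t ^ 2))
      (π / 2 * (rexp (-(4 * α)⁻¹ * ω ^ 2) / √(π * α))) ω := by
  rw [← integral_Ioi_cos_mul_gaussian hα]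
  refine (hasDerivAt_integral_of_dominated_loc_of_deriv_le
    (F := fun ω t => sin (ω * t) / t * rexp (-α * t ^ 2))
    (F' := fun ω t => cos (ω * t) * rexp (-α * t ^ 2))
    (bound := fun t => rexp (-α * t ^ 2)) univ_mem
    (Eventually.of_forall fun x => (integrable_sin_div_mul_gaussian hα x).1.restrict)
    (integrable_sin_div_mul_gaussian hα ω).integrableOn (by fun_prop) ?_
    (integrable_exp_neg_mul_sq hα).integrableOn ?_).2
  · refine ae_of_all _ fun t x _ => ?_
    rw [norm_mul, norm_of_nonneg (Real.exp_pos _).le]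
    exact mul_le_of_le_one_left (Real.exp_pos _).le (abs_cos_le_one _)
  · refine (ae_restrict_iff' measurableSet_Ioi).2 (ae_of_all _ fun t (ht : 0 < t) x _ => ?_)
    have h := (((hasDerivAt_id x).mul_const t).sin.div_const t).mul_const (rexp (-α * t ^ 2))
    refine h.congr_deriv ?_
    rw [id, one_mul, mul_div_cancel_right₀ _ ht.ne']

theorem integral_Ioi_sin_div_mul_gaussian (hα : 0 < α) (ω : ℝ) :
    ∫ t in Set.Ioi (0 : ℝ), sin (ω * t) / t * rexp (-α * t ^ 2) = π / 2 * smoothSign α ω := by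
  have hcont : Continuous fun ω : ℝ => π / 2 * (rexp (-(4 * α)⁻¹ * ω ^ 2) / √(π * α)) := by
    fun_prop
  have h := intervalIntegral.integral_eq_sub_of_hasDerivAt (a := 0) (b := ω)
    (fun x _ => hasDerivAt_integral_Ioi_sin_div_mul_gaussian hα x) (hcont.intervalIntegrable _ _)
  simpa [smoothSign] using h.symm

theorem integral_Ioi_mul_exp_neg_mul_sq (hα : 0 < α) (T : ℝ) :
    ∫ t in Set.Ioi T, t * rexp (-α * t ^ 2) = rexp (-α * T ^ 2) / (2 * α) := by
  have hderiv (t : ℝ) :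
      HasDerivAt (fun t => -rexp (-α * t ^ 2) / (2 * α)) (t * rexp (-α * t ^ 2)) t := by
    refine ((((hasDerivAt_pow 2 t).const_mul (-α)).exp.neg).div_const (2 * α)).congr_deriv ?_
    simp only [Nat.cast_ofNat, Nat.add_one_sub_one, pow_one]
    field_simp
  have hlim : Tendsto (fun t : ℝ => -rexp (-α * t ^ 2) / (2 * α)) atTop (𝓝 (-0 / (2 * α))) :=
    ((Real.tendsto_exp_atBot.comp ((tendsto_pow_atTop two_ne_zero).const_mul_atTop_of_neg
      (by linarith))).neg).div_const _
  rw [integral_Ioi_of_hasDerivAt_of_tendsto' (fun t _ => hderiv t)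
    (integrable_mul_exp_neg_mul_sq hα).integrableOn hlim]
  ring

section MinBound

variable {f : ℝ → ℝ} {η : ℝ}

theorem exp_neg_mul_sq_le_one (hα : 0 ≤ α) (t : ℝ) : rexp (-α * t ^ 2) ≤ 1 :=
  Real.exp_le_one_iff.2 (by nlinarith [sq_nonneg t])

theorem norm_integral_zero_one_le (hα : 0 ≤ α) (hη : 0 ≤ η)
    (hf : ∀ t, 0 < t → |f t| ≤ η * (min t 1 / t * rexp (-α * t ^ 2))) :
    ‖∫ t in (0 : ℝ)..1, f t‖ ≤ η := by
  have hbound : ∀ t ∈ Set.uIoc (0 : ℝ) 1, ‖f t‖ ≤ η := fun t ht => by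
    rw [Set.uIoc_of_le zero_le_one] at ht
    refine (hf t ht.1).trans (mul_le_of_le_one_right hη ?_)
    rw [min_eq_left ht.2, div_self ht.1.ne', one_mul]
    exact exp_neg_mul_sq_le_one hα t
  simpa using intervalIntegral.norm_integral_le_of_norm_le_const hbound

theorem norm_integral_one_le (hα : 0 ≤ α) (hη : 0 ≤ η)
    (hf : ∀ t, 0 < t → |f t| ≤ η * (min t 1 / t * rexp (-α * t ^ 2))) {T : ℝ} (hT : 1 ≤ T) :
    ‖∫ t in (1 : ℝ)..T, f t‖ ≤ η * log T := by
  have h0 : (0 : ℝ) ∉ Set.uIcc 1 T := by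
    rw [Set.uIcc_of_le hT]
    exact fun h => absurd h.1 (by norm_num)
  have hfi : ∫ t in (1 : ℝ)..T, η * (1 / t) = η * log T := by
    rw [intervalIntegral.integral_const_mul, integral_one_div h0, div_one]
  rw [← hfi]
  refine intervalIntegral.norm_integral_le_of_norm_le hT (ae_of_all _ fun t ht => ?_)
    ((intervalIntegral.intervalIntegrable_one_div
      (fun x hx h => h0 (h ▸ hx)) continuousOn_id).const_mul η)
  have ht0 : 0 < t := one_pos.trans ht.1
  refine (hf t ht0).trans ?_
  rw [min_eq_right ht.1.le]
  gcongr
  exact mul_le_of_le_one_right (by positivity) (exp_neg_mul_sq_le_one hα t)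

theorem norm_integral_Ioi_le (hα : 0 < α) (hη : 0 ≤ η)
    (hf : ∀ t, 0 < t → |f t| ≤ η * (min t 1 / t * rexp (-α * t ^ 2))) {T : ℝ} (hT : 1 ≤ T)
    (hαT : 1 ≤ α * T ^ 2) : ‖∫ t in Set.Ioi T, f t‖ ≤ η / 2 := by
  have hle (t : ℝ) (ht : T < t) : ‖f t‖ ≤ η * α * (t * rexp (-α * t ^ 2)) := by
    have ht0 : 0 < t := by linarith
    have hinv : 1 / t ≤ α * t := by
      rw [div_le_iff₀ ht0]
      nlinarith [mul_le_mul ht.le ht.le (by linarith) ht0.le]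
    calc ‖f t‖ ≤ η * (1 / t * rexp (-α * t ^ 2)) := by
          simpa only [min_eq_right (hT.trans ht.le), norm_eq_abs] using hf t ht0
      _ ≤ η * (α * t * rexp (-α * t ^ 2)) := by gcongr
      _ = η * α * (t * rexp (-α * t ^ 2)) := by ring
  calc ‖∫ t in Set.Ioi T, f t‖ ≤ ∫ t in Set.Ioi T, η * α * (t * rexp (-α * t ^ 2)) :=
        norm_integral_le_of_norm_le ((integrable_mul_exp_neg_mul_sq hα).integrableOn.const_mul _)
          ((ae_restrict_iff' measurableSet_Ioi).2 (ae_of_all _ hle))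
    _ = η / 2 * rexp (-α * T ^ 2) := by
        rw [integral_const_mul, integral_Ioi_mul_exp_neg_mul_sq hα]
        field_simp
    _ ≤ η / 2 := mul_le_of_le_one_right (by positivity) (exp_neg_mul_sq_le_one hα.le T)

-- The factor `1 / t` is integrated up to `T ≥ α^(-1/2)`, beyond which the Gaussian takes over.
theorem abs_integral_div_mul_gaussian_le (hα : 0 < α) {g : ℝ → ℝ} (hη : 0 ≤ η)
    (hfi : IntegrableOn (fun t => g t / t * rexp (-α * t ^ 2)) (Set.Ioi 0))
    (hg : ∀ t, 0 ≤ t → |g t| ≤ min t 1 * η) :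
    |∫ t in Set.Ioi (0 : ℝ), g t / t * rexp (-α * t ^ 2)| ≤
      η * (3 / 2 + log (max 1 α⁻¹) / 2) := by
  set f : ℝ → ℝ := fun t => g t / t * rexp (-α * t ^ 2)
  set T := √(max 1 α⁻¹) with hTdef
  have hm : 0 ≤ max 1 α⁻¹ := zero_le_one.trans (le_max_left _ _)
  have hT : 1 ≤ T := one_le_sqrt.2 (le_max_left _ _)
  have hαT : 1 ≤ α * T ^ 2 := by
    calc 1 = α * α⁻¹ := (mul_inv_cancel₀ hα.ne').symm
      _ ≤ α * T ^ 2 := by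
        rw [hTdef, sq_sqrt hm]
        gcongr
        exact le_max_right _ _
  have hf (t : ℝ) (ht : 0 < t) : |f t| ≤ η * (min t 1 / t * rexp (-α * t ^ 2)) := by
    rw [abs_mul, abs_div, abs_of_pos ht, abs_of_pos (Real.exp_pos _), ← mul_assoc, mul_div_assoc',
      mul_comm η]
    gcongr
    exact hg t ht.le
  have hii {a b : ℝ} (ha : 0 ≤ a) (hab : a ≤ b) : IntervalIntegrable f volume a b :=
    (intervalIntegrable_iff_integrableOn_Ioc_of_le hab).2
      (hfi.mono_set fun x hx => ha.trans_lt hx.1)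
  have hsplit : ∫ t in Set.Ioi (0 : ℝ), f t =
      (∫ t in (0 : ℝ)..1, f t) + (∫ t in (1 : ℝ)..T, f t) + ∫ t in Set.Ioi T, f t := by
    rw [intervalIntegral.integral_add_adjacent_intervals (hii le_rfl zero_le_one)
      (hii zero_le_one hT), intervalIntegral.integral_interval_add_Ioi hfi
      (hfi.mono_set (Set.Ioi_subset_Ioi (by linarith)))]
  calc |∫ t in Set.Ioi (0 : ℝ), f t| ≤ η + η * log T + η / 2 := by
        rw [hsplit]
        exact norm_add_le_of_le (norm_add_le_of_le (norm_integral_zero_one_le hα.le hη hf)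
          (norm_integral_one_le hα.le hη hf hT)) (norm_integral_Ioi_le hα hη hf hT hαT)
    _ = η * (3 / 2 + log (max 1 α⁻¹) / 2) := by
        rw [hTdef, log_sqrt hm]
        ring

end MinBound

end GaussianFilter

section TrigSum

open MeasureTheory Real ComplexConjugate

variable {ι : Type*} {s : Finset ι} {ν : ι → ℝ} {C : ι → ℂ} {η α κ δ : ℝ}

/-- The trigonometric sum with the frequencies `ν i` and the coefficients `C i`, for `i ∈ s`. -/
noncomputable def trigSum (s : Finset ι) (ν : ι → ℝ) (C : ι → ℂ) (t : ℝ) : ℂ :=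
  ∑ i ∈ s, Complex.exp (Complex.I * ν i * t) • C i

theorem trigSum_zero_right (s : Finset ι) (ν : ι → ℝ) (C : ι → ℂ) :
    trigSum s ν C 0 = ∑ i ∈ s, C i := by
  simp [trigSum]

theorem conj_trigSum (s : Finset ι) (ν : ι → ℝ) (C : ι → ℂ) (t : ℝ) :
    conj (trigSum s ν C t) = trigSum s (fun i => -ν i) (fun i => conj (C i)) t := by
  simp [trigSum, ← Complex.exp_conj]

theorem cexp_mul_trigSum (s : Finset ι) (ν : ι → ℝ) (C : ι → ℂ) (ω t : ℝ) :
    Complex.exp (Complex.I * ω * t) * trigSum s ν C t = trigSum s (fun i => ω + ν i) C t := by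
  simp only [trigSum, Finset.mul_sum, smul_eq_mul, ← mul_assoc, ← Complex.exp_add,
    Complex.ofReal_add, mul_add, add_mul]

theorem trigSum_im (s : Finset ι) (ν : ι → ℝ) (C : ι → ℂ) (t : ℝ) :
    (trigSum s ν C t).im =
      ∑ i ∈ s, ((C i).re * sin (ν i * t) + (C i).im * cos (ν i * t)) := by
  rw [trigSum, Complex.im_sum]
  refine Finset.sum_congr rfl fun i _ => ?_
  rw [show Complex.I * ν i * t = (ν i * t : ℝ) * Complex.I by push_cast; ring, smul_eq_mul,
    Complex.mul_im, Complex.exp_ofReal_mul_I_re, Complex.exp_ofReal_mul_I_im]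
  ring

theorem hasTimeMean_cexp_mul_trigSum_sub_conj {j : ι} (hj : j ∈ s) (hj₀ : ν j ≠ 0)
    (hν : ∀ i ∈ s, |ν i| = |ν j| → i = j) :
    HasTimeMean (fun t : ℝ => Complex.exp (Complex.I * (-ν j : ℝ) * t) *
      (trigSum s ν C t - conj (trigSum s ν C t))) (C j) := by
  have hpos : ∑ i ∈ s with -ν j + ν i = 0, C i = C j := by
    refine Finset.sum_eq_single_of_mem j (by simp [hj]) fun i hi hij => ?_
    obtain ⟨his, hi₀⟩ := Finset.mem_filter.1 hi
    exact absurd (hν i his (by rw [show ν i = ν j by linarith])) hij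
  have hneg : ∑ i ∈ s with -ν j + -ν i = 0, conj (C i) = 0 := by
    refine Finset.sum_eq_zero fun i hi => ?_
    obtain ⟨his, hi₀⟩ := Finset.mem_filter.1 hi
    have hij : ν i = -ν j := by linarith
    obtain rfl := hν i his (by rw [hij, abs_neg])
    exact absurd (by linarith) hj₀
  have hmean := (HasTimeMean.sum_cexp_smul s (fun i => -ν j + ν i) C).sub
    (HasTimeMean.sum_cexp_smul s (fun i => -ν j + -ν i) fun i => conj (C i))
  rw [hpos, hneg, sub_zero] at hmean
  simp only [conj_trigSum, mul_sub, cexp_mul_trigSum]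
  exact hmean

theorem norm_coeff_le (hF : ∀ t : ℝ, 0 ≤ t → |(trigSum s ν C t).im| ≤ η) {j : ι} (hj : j ∈ s)
    (hj₀ : ν j ≠ 0) (hν : ∀ i ∈ s, |ν i| = |ν j| → i = j) : ‖C j‖ ≤ 2 * η := by
  refine (hasTimeMean_cexp_mul_trigSum_sub_conj hj hj₀ hν).norm_le fun t ht => ?_
  have hphase : ‖Complex.exp (Complex.I * (-ν j : ℝ) * t)‖ = 1 := by simp [Complex.norm_exp]
  rw [norm_mul, hphase, one_mul, Complex.sub_conj]
  simpa using hF t ht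

theorem sum_re_mul_sin (s : Finset ι) (ν : ι → ℝ) (C : ι → ℂ) (t : ℝ) :
    ∑ i ∈ s, (C i).re * sin (ν i * t) =
      ((trigSum s ν C t).im - (trigSum s ν C (-t)).im) / 2 := by
  simp only [trigSum_im, mul_neg, sin_neg, cos_neg, Finset.sum_add_distrib, Finset.sum_neg_distrib]
  ring

theorem integral_sum_re_mul_sin_div_mul_gaussian (hα : 0 < α) (s : Finset ι) (ν : ι → ℝ)
    (C : ι → ℂ) :
    ∫ t in Set.Ioi 0, (∑ i ∈ s, (C i).re * sin (ν i * t)) / t * rexp (-α * t ^ 2) =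
      π / 2 * ∑ i ∈ s, (C i).re * smoothSign α (ν i) := by
  simp only [Finset.sum_div, Finset.sum_mul, mul_div_assoc, mul_assoc]
  rw [integral_finsetSum _ fun i _ =>
    ((integrable_sin_div_mul_gaussian hα (ν i)).const_mul _).integrableOn]
  simp only [integral_const_mul, integral_Ioi_sin_div_mul_gaussian hα, Finset.mul_sum]
  exact Finset.sum_congr rfl fun i _ => by ring

theorem abs_sum_re_mul_smoothSign_le (hα : 0 < α) (hη : 0 ≤ η)
    (hF : ∀ t : ℝ, |(trigSum s ν C t).im| ≤ min |t| 1 * η) :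
    |∑ i ∈ s, (C i).re * smoothSign α (ν i)| ≤ η / π * (3 + log (max 1 α⁻¹)) := by
  have hbound (t : ℝ) (ht : 0 ≤ t) : |∑ i ∈ s, (C i).re * sin (ν i * t)| ≤ min t 1 * η := by
    have h₁ := abs_le.1 (hF t)
    have h₂ := abs_le.1 (hF (-t))
    rw [abs_neg, abs_of_nonneg ht] at h₂
    rw [abs_of_nonneg ht] at h₁
    rw [sum_re_mul_sin]
    exact abs_le.2 ⟨by linarith, by linarith⟩
  have hfi : IntegrableOn
      (fun t => (∑ i ∈ s, (C i).re * sin (ν i * t)) / t * rexp (-α * t ^ 2)) (Set.Ioi 0) := by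
    simp only [Finset.sum_div, Finset.sum_mul, mul_div_assoc, mul_assoc]
    exact integrable_finsetSum _ fun i _ =>
      ((integrable_sin_div_mul_gaussian hα (ν i)).const_mul _).integrableOn
  have h := abs_integral_div_mul_gaussian_le hα hη hfi hbound
  rw [integral_sum_re_mul_sin_div_mul_gaussian hα, abs_mul, abs_of_pos (by positivity)] at h
  rw [div_mul_eq_mul_div, le_div_iff₀ pi_pos]
  linarith

theorem norm_sum_coeff_le (hα : 0 < α) (hη : 0 ≤ η)
    (hF : ∀ t : ℝ, |(trigSum s ν C t).im| ≤ min |t| 1 * η) (hν₀ : ∀ i ∈ s, ν i ≠ 0)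
    (hν : Set.InjOn (fun i => |ν i|) s)
    (hhigh : ‖∑ i ∈ s with κ < ν i, (1 - smoothSign α (ν i)) • C i‖ ≤ δ) :
    ‖∑ i ∈ s, C i‖ ≤
      η / π * (3 + log (max 1 α⁻¹)) + 4 * η * (s.filter (ν · ≤ κ)).card + δ := by
  have hreal : ‖∑ i ∈ s, C i‖ = |∑ i ∈ s, (C i).re| := by
    have him : (∑ i ∈ s, C i).im = 0 := by simpa [trigSum_zero_right] using hF 0
    rw [← Complex.re_sum, Complex.abs_re_eq_norm.2 him]
  have hsplit : ∑ i ∈ s, (C i).re = ∑ i ∈ s, (C i).re * smoothSign α (ν i) +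
      ∑ i ∈ s with ν i ≤ κ, (1 - smoothSign α (ν i)) * (C i).re +
      (∑ i ∈ s with κ < ν i, (1 - smoothSign α (ν i)) • C i).re := by
    simp only [Complex.re_sum, Complex.smul_re, smul_eq_mul, ← not_le]
    rw [add_assoc, Finset.sum_filter_add_sum_filter_not, ← Finset.sum_add_distrib]
    exact Finset.sum_congr rfl fun i _ => by ring
  have hlow : |∑ i ∈ s with ν i ≤ κ, (1 - smoothSign α (ν i)) * (C i).re| ≤
      4 * η * (s.filter (ν · ≤ κ)).card := by
    refine (Finset.abs_sum_le_sum_abs _ _).trans ?_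
    rw [mul_comm, ← nsmul_eq_mul]
    refine Finset.sum_le_card_nsmul _ _ _ fun i hi => ?_
    have his := Finset.mem_of_mem_filter i hi
    have hC : |(C i).re| ≤ 2 * η := (Complex.abs_re_le_norm _).trans <|
      norm_coeff_le (fun t _ => (hF t).trans (mul_le_of_le_one_left hη (min_le_right _ _))) his
        (hν₀ i his) fun j hj hji => hν hj his hji
    have hsign := abs_le.1 (abs_smoothSign_le_one hα (ν i))
    have hweight : |1 - smoothSign α (ν i)| ≤ 2 := abs_le.2 ⟨by linarith, by linarith⟩
    calc |(1 - smoothSign α (ν i)) * (C i).re| ≤ 2 * (2 * η) := by rw [abs_mul]; gcongr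
      _ = 4 * η := by ring
  rw [hreal, hsplit]
  exact (abs_add_three _ _ _).trans (add_le_add_three (abs_sum_re_mul_smoothSign_le hα hη hF) hlow
    ((Complex.abs_re_le_norm _).trans hhigh))

end TrigSum

section FilterWidth

open Real

theorem log_max_one_exp_one_mul_le (y : ℝ) :
    log (max 1 (rexp 1 * y)) ≤ 1 + log (max 1 y) := by
  have hmax : 0 < max 1 y := lt_max_of_lt_left one_pos
  calc log (max 1 (rexp 1 * y)) ≤ log (rexp 1 * max 1 y) :=
        log_le_log (lt_max_of_lt_left one_pos) <|
          max_le (one_le_mul_of_one_le_of_one_le (one_le_exp zero_le_one) (le_max_left _ _))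
            (by gcongr; exact le_max_right _ _)
    _ = 1 + log (max 1 y) := by rw [log_mul (exp_ne_zero 1) hmax.ne', log_exp]

theorem neg_inv_mul_sq_le {d κ : ℝ} (hd : 0 ≤ d) (hκ : κ ≠ 0) :
    -(4 * (rexp 1 * (π * d / κ ^ 2))⁻¹)⁻¹ * κ ^ 2 ≤ -d := by
  have hval : -(4 * (rexp 1 * (π * d / κ ^ 2))⁻¹)⁻¹ * κ ^ 2 = -(rexp 1 * π / 4 * d) := by
    rw [mul_inv, inv_inv]
    field_simp
  have hfour : 4 ≤ rexp 1 * π := by nlinarith [pi_gt_three, add_one_le_exp 1]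
  rw [hval, neg_le_neg_iff]
  nlinarith

end FilterWidth

namespace SpinLattice

open Matrix Real

section Filter

variable {S : Type*} [Fintype S] [DecidableEq S] {q : ℕ} {G A B : Op S q} {ψ : Conf S q → ℂ}
  {E η α κ : ℝ}

theorem correlation_heisenberg_eq_trigSum (hG : G.IsHermitian) (hψ : IsSimpleEigenvector G E ψ)
    (A B : Op S q) (t : ℝ) :
    correlation ψ A (heisenberg G t B) = trigSum ((realSpectrum G).erase E) (fun x => x - E)
      (fun x => expectation ψ (A * spectralProj G x * B)) t := by
  rw [correlation, expectation_heisenberg hG hψ.mulVec_eq,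
    expectation_mul_heisenberg hG hψ.mulVec_eq,
    ← Finset.add_sum_erase _ _ (hψ.mem_realSpectrum hG), hψ.spectralProj_eq hG,
    expectation_mul_vecMulVec_mul, trigSum]
  simp

theorem correlation_eq_sum (hG : G.IsHermitian) (hψ : IsSimpleEigenvector G E ψ)
    (A B : Op S q) : correlation ψ A B =
      ∑ x ∈ (realSpectrum G).erase E, expectation ψ (A * spectralProj G x * B) := by
  have hB : heisenberg G 0 B = B := by simp [heisenberg]
  rw [← trigSum_zero_right, ← correlation_heisenberg_eq_trigSum hG hψ, hB]

theorem correlation_im (ψ : Conf S q → ℂ) (hA : A.IsHermitian) (hB : B.IsHermitian) :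
    (correlation ψ A B).im = (expectation ψ (A * B)).im := by
  simp [correlation, expectation_im ψ hA, expectation_im ψ hB]

theorem norm_sum_smul_expectation_le (hψ : IsUnitVector ψ) (hA : ‖A‖ ≤ 1) (hB : ‖B‖ ≤ 1)
    {s : Finset ℝ} (hs : s ⊆ realSpectrum G) {f : ℝ → ℝ} {δ : ℝ} (hδ : 0 ≤ δ)
    (hf : ∀ x ∈ s, |f x| ≤ δ) :
    ‖∑ x ∈ s, f x • expectation ψ (A * spectralProj G x * B)‖ ≤ δ := by
  set w : ℝ → ℝ := fun x => if x ∈ s then f x else 0 with hw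
  have hsum : ∑ x ∈ s, f x • expectation ψ (A * spectralProj G x * B) =
      expectation ψ (A * (∑ x ∈ realSpectrum G, w x • spectralProj G x) * B) := by
    simp only [hw, ite_smul, zero_smul, Finset.sum_ite_mem, Finset.inter_eq_right.2 hs,
      ← expectationLin_apply, Finset.mul_sum, Finset.sum_mul, map_sum, mul_smul_comm,
      smul_mul_assoc, LinearMap.map_smul_of_tower]
  have hnorm : ‖∑ x ∈ realSpectrum G, w x • spectralProj G x‖ ≤ δ :=
    norm_sum_smul_spectralProj_le G hδ fun x _ => by
      by_cases hx : x ∈ s <;> simp [hw, hx, hδ, hf]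
  rw [hsum]
  calc _ ≤ ‖A‖ * ‖∑ x ∈ realSpectrum G, w x • spectralProj G x‖ * ‖B‖ :=
        (norm_expectation_le hψ _).trans (norm_mul₃_le)
    _ ≤ 1 * δ * 1 := by gcongr
    _ = δ := by ring

variable (hG : G.IsHermitian) (hψ : IsSimpleEigenvector G E ψ) (hA : A.IsHermitian)
  (hB : B.IsHermitian) (hE : Set.InjOn (fun x => |x - E|) (realSpectrum G))

include hG hψ hA hB hE

theorem correlation_eq_zero_of_im_eq_zero
    (him : ∀ t : ℝ, 0 ≤ t → (expectation ψ (A * heisenberg G t B)).im = 0) :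
    correlation ψ A B = 0 := by
  rw [correlation_eq_sum hG hψ]
  refine Finset.sum_eq_zero fun x hx => norm_le_zero_iff.1 ?_
  obtain ⟨hxE, hxG⟩ := Finset.mem_erase.1 hx
  have hzero : ∀ t : ℝ, 0 ≤ t → |(trigSum ((realSpectrum G).erase E) (fun x => x - E)
      (fun x => expectation ψ (A * spectralProj G x * B)) t).im| ≤ 0 := fun t ht => by
    rw [← correlation_heisenberg_eq_trigSum hG hψ, correlation_im ψ hA
      (isHermitian_heisenberg hG t hB), him t ht, abs_zero]
  simpa using norm_coeff_le hzero hx (sub_ne_zero.2 hxE)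
    fun y hy hyx => hE (Finset.mem_of_mem_erase hy) hxG hyx

theorem norm_correlation_le_of_abs_im_le (hA₁ : ‖A‖ ≤ 1) (hB₁ : ‖B‖ ≤ 1) (hη : 0 ≤ η)
    (him : ∀ t : ℝ, |(expectation ψ (A * heisenberg G t B)).im| ≤ min |t| 1 * η)
    (hα : 0 < α) (hκ : 0 ≤ κ) :
    ‖correlation ψ A B‖ ≤ η / π * (3 + log (max 1 α⁻¹)) +
      4 * η * (((realSpectrum G).erase E).filter (· - E ≤ κ)).card +
      rexp (-(4 * α)⁻¹ * κ ^ 2) := by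
  rw [correlation_eq_sum hG hψ]
  refine norm_sum_coeff_le hα hη (fun t => ?_) (fun x hx => ?_) (fun x hx y hy h => ?_) ?_
  · rw [← correlation_heisenberg_eq_trigSum hG hψ, correlation_im ψ hA
      (isHermitian_heisenberg hG t hB)]
    exact him t
  · exact sub_ne_zero.2 (Finset.ne_of_mem_erase hx)
  · exact hE (Finset.mem_of_mem_erase hx) (Finset.mem_of_mem_erase hy) h
  · refine norm_sum_smul_expectation_le hψ.unit hA₁ hB₁
      ((Finset.filter_subset _ _).trans (Finset.erase_subset _ _)) (exp_pos _).le fun x hx => ?_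
    have hκx : κ < x - E := (Finset.mem_filter.1 hx).2
    rw [abs_of_nonneg (one_sub_smoothSign_nonneg hα _)]
    refine (one_sub_smoothSign_le hα (hκ.trans hκx.le)).trans (exp_le_exp.2 ?_)
    rw [neg_mul, neg_mul, neg_le_neg_iff]
    gcongr

theorem norm_correlation_le_of_abs_im_le_exp {c d : ℝ} (hA₁ : ‖A‖ ≤ 1) (hB₁ : ‖B‖ ≤ 1)
    (hc : 0 ≤ c) (hd : 0 < d) (hκ : 0 < κ)
    (him : ∀ t : ℝ, |(expectation ψ (A * heisenberg G t B)).im| ≤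
      min |t| 1 * (c * rexp (-d) / 2)) :
    ‖correlation ψ A B‖ ≤
      (4 * π * (((realSpectrum G).erase E).filter (· - E ≤ κ)).card * c + 2 * π +
        c * (4 + log (max 1 (π * d / κ ^ 2)))) * (rexp (-d) / (2 * π)) := by
  have hfilter := norm_correlation_le_of_abs_im_le hG hψ hA hB hE hA₁ hB₁ (by positivity) him
    (α := (rexp 1 * (π * d / κ ^ 2))⁻¹) (by positivity) hκ.le
  rw [inv_inv] at hfilter
  calc _ ≤ _ := hfilter
    _ ≤ c * rexp (-d) / 2 / π * (3 + (1 + log (max 1 (π * d / κ ^ 2)))) +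
        4 * (c * rexp (-d) / 2) * (((realSpectrum G).erase E).filter (· - E ≤ κ)).card +
          rexp (-d) := by
      gcongr
      · exact log_max_one_exp_one_mul_le _
      · exact neg_inv_mul_sq_le hd.le hκ.ne'
    _ = _ := by field_simp; ring

end Filter

end SpinLattice

section MobilityFactor

open Real

/-- The factor in front of `e^{-μd} / (2π)` in the clustering bound below a mobility edge with
constant `c`, where `Θ` counts the states up to the energy `E + κ` and `y = πμd / κ²`. -/
noncomputable def mobilityFactor (Θ c y : ℝ) : ℝ :=
  4 * π * (Θ - 1) * c + 2 * π + c * (4 + log (max 1 y))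

variable {y c Θ : ℝ}

theorem mobilityFactor_le (hc : 0 ≤ c) (hΘ : 0 ≤ Θ) :
    mobilityFactor Θ c y ≤ 12 * π * Θ * c + 2 * π + c * log (rexp 4 * max 1 y) := by
  have hmax : 0 < max 1 y := lt_max_of_lt_left one_pos
  rw [mobilityFactor, log_mul (exp_ne_zero 4) hmax.ne', log_exp]
  nlinarith [pi_pos, mul_nonneg (mul_nonneg pi_pos.le hΘ) hc, mul_nonneg pi_pos.le hc]

theorem mobilityFactor_le_of_one_le (hc : 0 ≤ c) (hΘ : 0 ≤ Θ) (hy : 1 ≤ y * rexp 4)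
    (hcΘ : c ≤ 1 ∨ log (y * rexp 4) ≤ 4 * π * (2 * Θ + 1)) :
    mobilityFactor Θ c y ≤ 12 * π * Θ * c + log (y * rexp (4 + 2 * π)) := by
  have hy₀ : 0 < y := pos_of_mul_pos_left (one_pos.trans_le hy) (exp_pos 4).le
  have hlog := log_nonneg hy
  rw [log_mul hy₀.ne' (exp_ne_zero _), log_exp] at hlog hcΘ ⊢
  rw [mobilityFactor]
  have hπc : 0 ≤ π * c := mul_nonneg pi_pos.le hc
  have hπcΘ : 0 ≤ π * c * Θ := mul_nonneg hπc hΘ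
  rcases le_total y 1 with hy₁ | hy₁
  · rw [max_eq_left hy₁, log_one]
    nlinarith [pi_gt_three]
  · rw [max_eq_right hy₁]
    rcases hcΘ with hc₁ | hΘlog
    · nlinarith [mul_nonneg (sub_nonneg.2 hc₁) hlog]
    · nlinarith [mul_le_mul_of_nonneg_left hΘlog hc]

end MobilityFactor

namespace SpinLattice

open Matrix Real

theorem expDecay_nonneg (μ : ℝ) (D : ℕ∞) : 0 ≤ expDecay μ D := by
  rw [expDecay]
  split_ifs
  exacts [le_rfl, (exp_pos _).le]

theorem trace_vecMulVec_mul {S : Type*} [Fintype S] [DecidableEq S] {q : ℕ}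
    (ψ : Conf S q → ℂ) (A : Op S q) :
    (vecMulVec ψ (star ψ) * A).trace = expectation ψ A := by
  rw [vecMulVec_mul, trace_vecMulVec, dotProduct_comm, ← dotProduct_mulVec]
  rfl

namespace LocalHamiltonian

variable {V ι : Type*} [Fintype V] [DecidableEq V] [Fintype ι] {q : ℕ}
  (H : LocalHamiltonian V ι q) {X Y : Finset V} {A B : Op V q} {ψ : Conf V q → ℂ}
  {E Emob c μ κ : ℝ}

theorem exists_energy_eq {x : ℝ} (hx : x ∈ realSpectrum H.full) : ∃ k, H.energy k = x := by
  rwa [mem_realSpectrum, H.full_isHermitian.spectrum_real_eq_range_eigenvalues] at hx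

theorem card_realSpectrum_filter_le (E : ℝ) :
    ((realSpectrum H.full).filter (· ≤ E)).card ≤ H.numStates E := by
  classical
  rw [numStates, Nat.card_eq_fintype_card, Fintype.card_subtype]
  refine (Finset.card_le_card fun x hx => ?_).trans (Finset.card_image_le (f := H.energy))
  obtain ⟨hx, hxE⟩ := Finset.mem_filter.1 hx
  obtain ⟨k, rfl⟩ := H.exists_energy_eq hx
  exact Finset.mem_image_of_mem _ (Finset.mem_filter.2 ⟨Finset.mem_univ k, hxE⟩)

theorem card_erase_filter_add_one_le (hE : E ∈ realSpectrum H.full) (hκ : 0 ≤ κ) :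
    (((realSpectrum H.full).erase E).filter (· - E ≤ κ)).card + 1 ≤ H.numStates (E + κ) := by
  have hE' : E ∈ (realSpectrum H.full).filter (· ≤ E + κ) := by simp [hE, hκ]
  refine le_trans (le_of_eq ?_) (H.card_realSpectrum_filter_le (E + κ))
  simp only [sub_le_iff_le_add']
  rw [Finset.filter_erase, Finset.card_erase_add_one hE']

variable {H}

theorem abs_im_expectation_heisenberg_mul_le (hmob : H.HasMobilityEdge Emob c μ)
    (hXY : Disjoint X Y) (hA : IsObservableOn X A) (hB : IsObservableOn Y B)
    (hψ : IsUnitVector ψ) (hE : H.IsEigen ψ E) (hEm : E ≤ Emob) {t : ℝ} (ht : 0 ≤ t) :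
    |(expectation ψ (heisenberg H.full t A * B)).im| ≤
      min t 1 * (c * expDecay μ (H.dist X Y) / 2) := by
  have htrace : (vecMulVec ψ (star ψ)).trace = 1 := by
    rw [trace_vecMulVec, dotProduct_comm, hψ]
  have hbound := hmob.2.2 _ (Submodule.subset_span ⟨ψ, ψ, E, E, hE, hE, hEm, hEm, rfl⟩)
    (posSemidef_vecMulVec_self_star ψ) htrace X Y hXY A B hA hB t ht
  rw [trace_vecMulVec_mul, norm_expectation_commutator ψ
    (isHermitian_heisenberg H.full_isHermitian t hA.1) hB.1] at hbound
  linarith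

theorem abs_im_expectation_mul_heisenberg_le (hmob : H.HasMobilityEdge Emob c μ)
    (hXY : Disjoint X Y) (hA : IsObservableOn X A) (hB : IsObservableOn Y B)
    (hψ : IsUnitVector ψ) (hE : H.IsEigen ψ E) (hEm : E ≤ Emob) (t : ℝ) :
    |(expectation ψ (A * heisenberg H.full t B)).im| ≤
      min |t| 1 * (c * expDecay μ (H.dist X Y) / 2) := by
  rcases le_total 0 t with ht | ht
  · have hB' := isHermitian_heisenberg H.full_isHermitian t hB.1
    have hswap : expectation ψ (A * heisenberg H.full t B) =
        star (expectation ψ (heisenberg H.full t B * A)) := by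
      rw [← expectation_conjTranspose, conjTranspose_mul, hA.1.eq, hB'.eq]
    rw [hswap, abs_of_nonneg ht, H.dist_comm X Y, Complex.star_def, Complex.conj_im, abs_neg]
    exact abs_im_expectation_heisenberg_mul_le hmob hXY.symm hB hA hψ hE hEm ht
  · rw [abs_of_nonpos ht, ← neg_neg t, ← expectation_heisenberg_mul H.full_isHermitian hE, neg_neg]
    exact abs_im_expectation_heisenberg_mul_le hmob hXY hA hB hψ hE hEm (neg_nonneg.2 ht)

theorem norm_correlation_le_of_mobilityEdge (hmob : H.HasMobilityEdge Emob c μ)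
    (hXY : Disjoint X Y) (hA : IsObservableOn X A) (hB : IsObservableOn Y B)
    (hψ : IsSimpleEigenvector H.full E ψ) (hEm : E ≤ Emob)
    (hgap : ∀ r s, |H.energy r - E| = |H.energy s - E| → H.energy r = H.energy s)
    (hκ : 0 < κ) :
    ‖correlation ψ A B‖ ≤
      mobilityFactor (H.numStates (E + κ)) c (π * μ * (H.dist X Y).toNat / κ ^ 2) *
        (expDecay μ (H.dist X Y) / (2 * π)) := by
  have hinj : Set.InjOn (fun x => |x - E|) (realSpectrum H.full) := fun x hx y hy h => by
    obtain ⟨r, rfl⟩ := H.exists_energy_eq hx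
    obtain ⟨s, rfl⟩ := H.exists_energy_eq hy
    exact hgap r s h
  have him := abs_im_expectation_mul_heisenberg_le hmob hXY hA hB hψ.unit hψ.mulVec_eq hEm
  obtain ⟨hc, hμ, -⟩ := hmob
  have hE := hψ.mem_realSpectrum H.full_isHermitian
  by_cases htop : H.dist X Y = ⊤
  · have hzero : expDecay μ (H.dist X Y) = 0 := if_pos htop
    rw [correlation_eq_zero_of_im_eq_zero H.full_isHermitian hψ hA.1 hB.1 hinj fun t _ => by
      simpa [hzero] using him t, hzero, norm_zero, zero_div, mul_zero]
  have hdecay : expDecay μ (H.dist X Y) = rexp (-(μ * (H.dist X Y).toNat)) := by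
    rw [expDecay, if_neg htop, neg_mul]
  have hdist : 0 < (H.dist X Y).toNat :=
    ENat.toNat_pos (one_pos.trans_le (H.one_le_dist hXY)).ne' htop
  have hcard : ((((realSpectrum H.full).erase E).filter (· - E ≤ κ)).card : ℝ) ≤
      H.numStates (E + κ) - 1 := by
    rw [le_sub_iff_add_le]
    exact_mod_cast H.card_erase_filter_add_one_le hE hκ.le
  rw [hdecay] at him
  rw [hdecay, mobilityFactor, mul_assoc π μ]
  refine (norm_correlation_le_of_abs_im_le_exp H.full_isHermitian hψ hA.1 hB.1 hinj hA.2.2.le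
    hB.2.2.le hc.le (by positivity) hκ him).trans ?_
  gcongr

end LocalHamiltonian

end SpinLattice

namespace SpinLattice.LocalHamiltonian

variable {V ι : Type*} [DecidableEq V] [Fintype ι] {q : ℕ} {H : LocalHamiltonian V ι q}

theorem LocallyIndependentGaps.regionEnergy_eq {R S : Finset V}
    (hgap : H.LocallyIndependentGaps R S) (a a' : Conf R q) (b b' : Conf S q)
    (h : H.regionEnergy R a - H.regionEnergy R a' = H.regionEnergy S b - H.regionEnergy S b') :
    H.regionEnergy R a = H.regionEnergy R a' :=
  congrArg _ (hgap.2.2 a a' b b' h).1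

variable [Fintype V] {ψ : Conf V q → ℂ} {E : ℝ}

theorem NondegenerateEnergies.isSimpleEigenvector (hnd : H.NondegenerateEnergies)
    (hunit : IsUnitVector ψ) (hψ : H.IsEigen ψ E) : IsSimpleEigenvector H.full E ψ :=
  isSimpleEigenvector_of_injective_eigenvalues H.full_isHermitian hnd hunit hψ

theorem NonsymmetricGaps.energy_eq (hgap : H.NonsymmetricGaps) (hE : E ∈ realSpectrum H.full)
    (r s : Conf V q) (h : |H.energy r - E| = |H.energy s - E|) : H.energy r = H.energy s := by
  obtain ⟨ζ, hζ, hgap⟩ := hgap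
  obtain ⟨k, rfl⟩ := H.exists_energy_eq hE
  by_contra hrs
  have := hgap k r s fun hrs' => hrs (congrArg _ hrs')
  rw [h, sub_self, abs_zero] at this
  exact this.not_gt hζ

end SpinLattice.LocalHamiltonian

open SpinLattice in
theorem theorem1_general {V ι : Type*} [Fintype V] [DecidableEq V] [Fintype ι] {q : ℕ}
    (H : LocalHamiltonian V ι q) {X Y : Finset V} (hXY : Disjoint X Y) {A B : Op V q}
    (hA : IsObservableOn X A) (hB : IsObservableOn Y B) {ψ : Conf V q → ℂ} {E : ℝ}
    (hψ : IsSimpleEigenvector H.full E ψ) :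
    (∀ c μ : ℝ, H.StrongDynamicalLocalisation c μ →
      (∀ a a' b b', H.regionEnergy (H.halfway X Y) a - H.regionEnergy (H.halfway X Y) a' =
        H.regionEnergy (H.halfway Y X) b - H.regionEnergy (H.halfway Y X) b' →
          H.regionEnergy (H.halfway X Y) a = H.regionEnergy (H.halfway X Y) a') →
      ‖correlation ψ A B‖ ≤ 4 * c * expDecay (μ / 2) (H.dist X Y)) ∧
    (∀ Emob c μ : ℝ, H.HasMobilityEdge Emob c μ →
      (∀ r s, |H.energy r - E| = |H.energy s - E| → H.energy r = H.energy s) → E ≤ Emob →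
      ∀ κ : ℝ, 0 < κ →
        ‖correlation ψ A B‖ ≤ (12 * Real.pi * H.numStates (E + κ) * c + 2 * Real.pi +
          c * Real.log (Real.exp 4 * max 1 (Real.pi * μ * (H.dist X Y).toNat / κ ^ 2))) *
            (expDecay μ (H.dist X Y) / (2 * Real.pi)) ∧
        (1 ≤ Real.pi * μ * (H.dist X Y).toNat * Real.exp 4 / κ ^ 2 →
          (c ≤ 1 ∨ Real.log (Real.pi * μ * (H.dist X Y).toNat * Real.exp 4 / κ ^ 2) ≤
            4 * Real.pi * (2 * H.numStates (E + κ) + 1)) →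
          ‖correlation ψ A B‖ ≤ (12 * Real.pi * H.numStates (E + κ) * c +
            Real.log (Real.pi * μ * (H.dist X Y).toNat * Real.exp (4 + 2 * Real.pi) / κ ^ 2)) *
              (expDecay μ (H.dist X Y) / (2 * Real.pi)))) := by
  refine ⟨fun c μ hloc hgap => H.norm_correlation_le_of_stronglyLocalised hloc hXY hgap hA hB hψ,
    fun Emob c μ hmob hgap hEm κ hκ => ?_⟩
  have hsharp := LocalHamiltonian.norm_correlation_le_of_mobilityEdge hmob hXY hA hB hψ hEm hgap hκ
  have hdecay : 0 ≤ expDecay μ (H.dist X Y) / (2 * Real.pi) :=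
    div_nonneg (expDecay_nonneg _ _) Real.two_pi_pos.le
  have hΘ : (0 : ℝ) ≤ H.numStates (E + κ) := Nat.cast_nonneg _
  rw [mul_div_right_comm _ (Real.exp 4), mul_div_right_comm _ (Real.exp (4 + 2 * Real.pi))]
  refine ⟨hsharp.trans ?_, fun hy hcΘ => hsharp.trans ?_⟩
  · exact mul_le_mul_of_nonneg_right (mobilityFactor_le hmob.1.le hΘ) hdecay
  · exact mul_le_mul_of_nonneg_right (mobilityFactor_le_of_one_le hmob.1.le hΘ hy hcΘ) hdecay

theorem theorem1 {V ι : Type*} [Fintype V] [DecidableEq V] [Fintype ι] {q : ℕ}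
    (H : SpinLattice.LocalHamiltonian V ι q) :
    -- part a
    (∀ c μ : ℝ, H.StrongDynamicalLocalisation c μ → H.NondegenerateEnergies →
      ∀ X Y : Finset V, Disjoint X Y →
      H.LocallyIndependentGaps (H.halfway X Y) (H.halfway Y X) →
      ∀ A B : SpinLattice.Op V q,
      SpinLattice.IsObservableOn X A → SpinLattice.IsObservableOn Y B →
      ∀ (ψ : SpinLattice.Conf V q → ℂ) (E : ℝ),
      SpinLattice.IsUnitVector ψ → H.IsEigen ψ E →
        ‖SpinLattice.expectation ψ (A * B)
            - SpinLattice.expectation ψ A * SpinLattice.expectation ψ B‖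
          ≤ 4 * c * SpinLattice.expDecay (μ / 2) (H.dist X Y)) ∧
    -- part b
    (∀ Emob c μ : ℝ, H.HasMobilityEdge Emob c μ → H.NondegenerateEnergies →
      H.NonsymmetricGaps →
      ∀ X Y : Finset V, Disjoint X Y → ∀ A B : SpinLattice.Op V q,
      SpinLattice.IsObservableOn X A → SpinLattice.IsObservableOn Y B →
      ∀ (ψ : SpinLattice.Conf V q → ℂ) (E : ℝ),
      SpinLattice.IsUnitVector ψ → H.IsEigen ψ E → E ≤ Emob →
      ∀ κ : ℝ, 0 < κ →
        ‖SpinLattice.expectation ψ (A * B)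
            - SpinLattice.expectation ψ A * SpinLattice.expectation ψ B‖
          ≤ (12 * Real.pi * H.numStates (E + κ) * c + 2 * Real.pi
              + c * Real.log (Real.exp 4
                  * max 1 (Real.pi * μ * (H.dist X Y).toNat / κ ^ 2)))
            * (SpinLattice.expDecay μ (H.dist X Y) / (2 * Real.pi)) ∧
        (1 ≤ Real.pi * μ * (H.dist X Y).toNat * Real.exp 4 / κ ^ 2 →
          (c ≤ 1 ∨ Real.log (Real.pi * μ * (H.dist X Y).toNat * Real.exp 4 / κ ^ 2)
            ≤ 4 * Real.pi * (2 * H.numStates (E + κ) + 1)) →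
          ‖SpinLattice.expectation ψ (A * B)
              - SpinLattice.expectation ψ A * SpinLattice.expectation ψ B‖
            ≤ (12 * Real.pi * H.numStates (E + κ) * c
                + Real.log (Real.pi * μ * (H.dist X Y).toNat
                    * Real.exp (4 + 2 * Real.pi) / κ ^ 2))
              * (SpinLattice.expDecay μ (H.dist X Y) / (2 * Real.pi)))) := by
  refine ⟨fun c μ hloc hnd X Y hXY hgap A B hA hB ψ E hunit hE =>
    (theorem1_general H hXY hA hB (hnd.isSimpleEigenvector hunit hE)).1 c μ hloc
      hgap.regionEnergy_eq, ?_⟩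
  intro Emob c μ hmob hnd hgap X Y hXY A B hA hB ψ E hunit hE hEm κ hκ
  have hψ := hnd.isSimpleEigenvector hunit hE
  exact (theorem1_general H hXY hA hB hψ).2 Emob c μ hmob
    (hgap.energy_eq (hψ.mem_realSpectrum H.full_isHermitian)) hEm κ hκ
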